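/- Let $\mathbb{H}$ be a separable real Hilbert space and $X$ a random element of $\mathbb{H}$ that is regularly varying with index $\alpha>0$: there are a nonzero Borel measure $\mu$ on $\mathbb{H}\setminus\{0\}$, finite on sets bounded away from $0$ and satisfying $\mu(tA)=t^{-\alpha}\mu(A)$ for $t>0$, and a regularly varying function $b$, such that $b(n)\,\mathbb{E}[f(X/n)]\to\int f\,d\mu$ as $n\to\infty$ for every bounded continuous function $f$ vanishing in a neighbourhood of $0$. Put $R=\|X\|$, $\Theta=X/\|X\|$, and let $\Theta_\infty$ be distributed according to the limit angular measure $P_{\Theta,\infty}(B)=\mu\{\|x\|>1,\ x/\|x\|\in B\}/\mu\{\|x\|>1\}$, which is the weak limit of the law of $\Theta$ given $R>t$ as $t\to\infty$. Let $$C_t=\mathbb{E}[\Theta\otimes\Theta\mid R>t],\qquad C_\infty=\mathbb{E}[\Theta_\infty\otimes\Theta_\infty].$$ For each $n$ let $X_1,\dots,X_n$ be an i.i.d. sample with the law of $X$, ordered as $\|X_{(1)}\|\ge\dots\ge\|X_{(n)}\|$ (ties broken arbitrarily), and for $1\le k\le n$ let $\Theta_{(i)}=X_{(i)}/\|X_{(i)}\|$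 (with the convention $0/\|0\|=0$), let $\widehat C_k=\frac1k\sum_{i=1}^k\Theta_{(i)}\otimes\Theta_{(i)}$, and let $t_{n,k}=\inf\{s\ge 0:\mathbb{P}(R\le s)\ge 1-k/n\}$ be the $(1-k/n)$-quantile of $R$. For a nonnegative self-adjoint compact operator $C$ on $\mathbb{H}$ with eigenvalues $\lambda_1(C)\ge\lambda_2(C)\ge\dots\ge 0$ (repeated according to multiplicity, and completed by zeros), write $\Delta_p(C)=(\lambda_p(C)-\lambda_{p+1}(C))/2$, and call a linear span of $p$ orthonormal eigenvectors with respective eigenvalues $\lambda_1(C),\dots,\lambda_p(C)$ a $p$-dimensional leading eigenspace of $C$; it is unique if $\Delta_p(C)>0$. Let $V^p_t$, $V^p_\infty$, $\widehat V^p_k$ be leading eigenspaces of $C_t$, $C_\infty$, $\widehat C_k$ (any choice of $\widehat V^p_k$ is allowed if it is not unique), and let $\rho(V,W)=\|\Pi_V-\Pi_W\|_{HS(\mathbb{H})}$, where $\Pi_V$ is the orthogonal projection onto $V$. Let $p\ge 1$ be such that $\Delta_p(C_\infty)>0$. 1. Let $1\le k\le n$ be such that $\Delta_p(C_{t_{n,k}})>0$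 and $\mathbb{P}(R>t_{n,k})=k/n$ (the latter is automatic for $k<n$ if the distribution function of $R$ is continuous). For every $\delta\in(0,1)$, with probability at least $1-\delta$, $$\rho(\widehat V^p_k,V^p_{t_{n,k}})\le\frac{B(n,k,\delta)}{\Delta_p(C_{t_{n,k}})},$$ where $$B(n,k,\delta)=\frac{1+4\sqrt{\log(2/\delta)}+\sqrt{8\log(4/\delta)}}{\sqrt k}+\frac{8\log(2/\delta)+4\log(4/\delta)}{3k}.$$ 2. As $n,k\to\infty$ with $k/n\to0$, $\rho(\widehat V^p_k,V^p_\infty)\to0$ in probability. -/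

import Mathlib

open MeasureTheory ProbabilityTheory Filter Topology Set
open scoped ENNReal BoundedContinuousFunction Pointwise

noncomputable section

namespace ExtremePCA

variable {H : Type*} [NormedAddCommGroup H] [InnerProductSpace ℝ H]
variable {Ω : Type*} [MeasurableSpace Ω]

/-! ### Regular variation in a Hilbert space -/

/-- A measurable function `b : ℝ → ℝ` is regularly varying with index `ρ`:
`b (t x) / b t → x ^ ρ` as `t → ∞`, for every `x > 0`. -/
def IsRegVarFun (b : ℝ → ℝ) (ρ : ℝ) : Prop :=
  Measurable b ∧ ∀ x : ℝ, 0 < x → Tendsto (fun t : ℝ => b (t * x) / b t) atTop (𝓝 (x ^ ρ))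

/-- Measures of the class `M₀`: Borel measures on `H ∖ {0}` (seen as measures on `H` that do not
charge `0`) which are finite on every Borel set bounded away from `0`. -/
structure IsM0 [MeasurableSpace H] (μ : Measure H) : Prop where
  zero_singleton : μ {0} = 0
  finite_away : ∀ ε : ℝ, 0 < ε → μ {x | ε ≤ ‖x‖} < ∞

/-- Convergence in `M₀`: convergence of the integrals of all bounded continuous functions that
vanish in a neighbourhood of `0`. Such functions do not see the mass at `0`, and a bounded
continuous function on `H ∖ {0}` vanishing near `0` is the same thing as one on `H`. -/
def TendstoM0 [MeasurableSpace H] (ν : ℕ → Measure H) (μ : Measure H) : Prop :=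
  ∀ f : H →ᵇ ℝ, (∃ ε : ℝ, 0 < ε ∧ ∀ x, ‖x‖ < ε → f x = 0) →
    Tendsto (fun n => ∫ x, f x ∂(ν n)) atTop (𝓝 (∫ x, f x ∂μ))

/-- The random element `X` is regularly varying with index `α` and limit measure `μ`:
`b(n) P(X ∈ n ·) → μ` in `M₀` for some regularly varying function `b`, where `μ ≠ 0` belongs to
`M₀`, and `α` is the index of homogeneity of `μ`, that is `μ (t A) = t ^ (-α) μ A`. -/
structure IsRegularlyVarying [MeasurableSpace H] (P : Measure Ω) (X : Ω → H) (α : ℝ)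
    (μ : Measure H) : Prop where
  isM0 : IsM0 μ
  ne_zero : μ ≠ 0
  tendsto : ∃ (b : ℝ → ℝ) (ρ : ℝ), IsRegVarFun b ρ ∧
    TendstoM0 (fun n : ℕ => ENNReal.ofReal (b n) • P.map (fun ω => (n : ℝ)⁻¹ • X ω)) μ
  homogeneous : ∀ t : ℝ, 0 < t → ∀ A : Set H, MeasurableSet A →
    μ (t • A) = ENNReal.ofReal (t ^ (-α)) * μ A

/-- The angle `θ(x) = x / ‖x‖` (equal to `0` at `x = 0`). -/
def angle (x : H) : H := ‖x‖⁻¹ • x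

/-- The limit angular distribution `P_{Θ,∞}` attached to the limit measure `μ`:
`P_{Θ,∞}(B) = μ {‖x‖ > 1, θ(x) ∈ B} / μ {‖x‖ > 1}`. -/
def angularMeasure [MeasurableSpace H] (μ : Measure H) : Measure H :=
  (μ[|{x : H | 1 < ‖x‖}]).map angle

/-! ### Covariance operators of the angle -/

/-- The operator `x ⊗ x : h ↦ ⟪x, h⟫ x`. -/
def tensorSq (x : H) : H →L[ℝ] H := InnerProductSpace.rankOne ℝ x x

/-- `C_t = E[Θ ⊗ Θ | ‖X‖ > t]`. -/
def condCov (P : Measure Ω) (X : Ω → H) (t : ℝ) : H →L[ℝ] H :=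
  ∫ ω, tensorSq (angle (X ω)) ∂(P[|{ω | t < ‖X ω‖}])

/-- `C_∞ = E[Θ_∞ ⊗ Θ_∞]` where `Θ_∞` has the limit angular distribution attached to `μ`. -/
def limitCov [MeasurableSpace H] (μ : Measure H) : H →L[ℝ] H :=
  ∫ s, tensorSq s ∂(angularMeasure μ)

/-- `t_{n,k}`: the `1 - k/n` quantile of the (nonnegative) variable `‖X‖`. -/
def radialQuantile (P : Measure Ω) (X : Ω → H) (n k : ℕ) : ℝ :=
  sInf {s : ℝ | 0 ≤ s ∧ 1 - (k : ℝ) / n ≤ P.real {ω | ‖X ω‖ ≤ s}}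

/-- The permutation `σ` puts the sample `x` in order of nonincreasing norms:
`x (σ 0), x (σ 1), …` are `X_(1), X_(2), …` (ties are broken arbitrarily). -/
def IsNormSorted {n : ℕ} (x : Fin n → H) (σ : Equiv.Perm (Fin n)) : Prop :=
  Antitone fun i => ‖x (σ i)‖

/-- `Ĉ_k = (1/k) ∑_{i ≤ k} Θ_(i) ⊗ Θ_(i)`, for the ordering `σ` of the sample `x`. -/
def empCov {n : ℕ} (x : Fin n → H) (σ : Equiv.Perm (Fin n)) (k : ℕ) : H →L[ℝ] H :=
  (k : ℝ)⁻¹ • ∑ i : Fin n, if i.val < k then tensorSq (angle (x (σ i))) else 0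

/-! ### Eigenvalues, leading eigenspaces, Hilbert-Schmidt distance -/

/-- For `j ≥ 1` and `C` compact, self-adjoint and nonnegative, the `j`-th largest eigenvalue of `C`,
counted with multiplicity: the largest `r ≥ 0` such that there are `j` orthonormal eigenvectors
with eigenvalues at least `r`. (It is `0` if `j` exceeds the dimension of `H`.) -/
def eigenvalue (C : H →L[ℝ] H) (j : ℕ) : ℝ :=
  sSup {r : ℝ | 0 ≤ r ∧ ∃ v : Fin j → H, Orthonormal ℝ v ∧ ∀ i, ∃ c : ℝ, r ≤ c ∧ C (v i) = c • v i}

/-- The (half) eigengap `Δ_p = (λ_p - λ_{p+1}) / 2`. -/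
def eigengap (C : H →L[ℝ] H) (p : ℕ) : ℝ := (eigenvalue C p - eigenvalue C (p + 1)) / 2

/-- `V` is spanned by `p` orthonormal eigenvectors of `C` for the first `p` eigenvalues
`λ_1 ≥ … ≥ λ_p`. -/
def IsLeadingEigenspace (C : H →L[ℝ] H) (p : ℕ) (V : Submodule ℝ H) : Prop :=
  ∃ φ : Fin p → H, Orthonormal ℝ φ ∧ (∀ j, C (φ j) = eigenvalue C (j + 1) • φ j) ∧
    V = Submodule.span ℝ (Set.range φ)

/-- The Hilbert-Schmidt norm `(∑ ‖T e‖²)^{1/2}`, the sum being over a Hilbert basis of `H`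
(the value does not depend on the basis; it is `∞` if `T` is not Hilbert-Schmidt). -/
def hsNorm [CompleteSpace H] (T : H →L[ℝ] H) : ℝ≥0∞ :=
  (∑' e : (exists_hilbertBasis ℝ H).choose, ‖T (e : H)‖ₑ ^ 2) ^ (1 / 2 : ℝ)

/-- `ρ(V, W) = ‖Π_V - Π_W‖_HS` for finite dimensional subspaces. -/
def rho [CompleteSpace H] (V W : Submodule ℝ H) [FiniteDimensional ℝ V] [FiniteDimensional ℝ W] :
    ℝ≥0∞ :=
  hsNorm (V.starProjection - W.starProjection)

/-- The bound `B(n,k,δ)` (which depends on `k` and `δ` only). -/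
def statBound (k : ℕ) (δ : ℝ) : ℝ :=
  (1 + 4 * √(Real.log (2 / δ)) + √(8 * Real.log (4 / δ))) / √k
    + (8 * Real.log (2 / δ) + 4 * Real.log (4 / δ)) / (3 * k)

end ExtremePCA

end

/-! Hilbert-Schmidt operators are encoded by their values on a Hilbert basis, as elements of the
Hilbert space `ℓ²(ι, H)`. There `x ⊗ x` becomes `tens b x x`, and Bochner integrals, Cauchy-Schwarz
and concentration inequalities are available in Hilbert-Schmidt norm. The predicate `Represents`
links such an element to its operator.

Geometry (`rho_le_of_represents`). Let `V`, `W` be leading eigenspaces of `A`, `B`, and let `s =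
⟪Π_V, Π_W⟫`, so that `‖Π_V - Π_W‖² = 2 (p - s)`. By `trace_sub_trace_ge`, `V` beats `W` in the trace
of `A` by at least `2 Δ_p(A) (p - s)`, and `W` does at least as well as `V` for `B`. Adding gives
`Δ_p(A) ‖Π_W - Π_V‖² ≤ ⟪Π_W - Π_V, B - A⟫`, and Cauchy-Schwarz yields `ρ(W, V) ≤ ‖B - A‖ / Δ_p(A)`.
No gap is needed for `B`.

Probability. Among sorted observations, the `k` largest and those above a threshold `t` are nested
sets, so exchanging them costs at most `|N_t - k|`, with `N_t` the number of exceedances. Both the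
sum of `Θ ⊗ Θ` over exceedances and `N_t` are sums of i.i.d. bounded terms of variance at most `P(R
> t)`. A dimension-free Bernstein inequality (`bernstein_hilbert`) applies to each with variance
budget `k`, which produces the rate `1/√k`.

Limit. Regular variation, homogeneity and a finite-dimensional truncation show that `C_t → C_∞` in
Hilbert-Schmidt norm and that `P(R > t) / P(R ≥ t) → 1` (`IsRegularlyVarying.tail`). The second fact
makes atoms of `R` harmless at high quantiles, so consistency follows from the same deviation bound.
-/

noncomputable section

namespace ExtremePCA

/-! ### Hilbert-Schmidt operators as elements of `ℓ²(ι, H)`. -/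

section HilbertSchmidt

variable {H : Type*} [NormedAddCommGroup H] [InnerProductSpace ℝ H] {ι : Type*}

lemma hasSum_norm_sq_inner_smul (b : HilbertBasis ι ℝ H) (x y : H) :
    HasSum (fun i => ‖inner ℝ (b i) x • y‖ ^ 2) ((‖x‖ * ‖y‖) ^ 2) := by
  have h := (b.hasSum_inner_mul_inner x x).mul_right (‖y‖ ^ 2)
  rw [real_inner_self_eq_norm_sq, ← mul_pow] at h
  convert! h using 2 with i
  rw [norm_smul, mul_pow, real_inner_comm, Real.norm_eq_abs, sq_abs, sq]

/-- The Hilbert-Schmidt operator `z ↦ ⟪x, z⟫ y`, seen in `ℓ²(ι, H)` through its values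
on a Hilbert basis; the map is bilinear and continuous. -/
def tens (b : HilbertBasis ι ℝ H) : H →L[ℝ] H →L[ℝ] lp (fun _ : ι => H) 2 :=
  LinearMap.mkContinuous₂
    (LinearMap.mk₂ ℝ
      (fun x y => (⟨fun i => inner ℝ (b i) x • y, memℓp_gen (by
        simpa using (hasSum_norm_sq_inner_smul b x y).summable)⟩ : lp (fun _ : ι => H) 2))
      (fun x x' y => by ext i; simp [inner_add_right, add_smul]; rfl)
      (fun c x y => by ext i; simp [inner_smul_right, mul_smul])
      (fun x y y' => by ext i; simp; rfl)
      (fun c x y => by ext i; simp [smul_comm c]))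
    1 (fun x y => by
      rw [one_mul]
      refine le_of_sq_le_sq ?_ (by positivity)
      rw [← real_inner_self_eq_norm_sq]
      refine le_of_eq ((lp.hasSum_inner _ _).unique ?_)
      simpa using hasSum_norm_sq_inner_smul b x y)

lemma tens_apply (b : HilbertBasis ι ℝ H) (x y : H) (i : ι) :
    tens b x y i = inner ℝ (b i) x • y := rfl

/-- `w ∈ ℓ²(ι, H)` lists the values of the operator `T` on the Hilbert basis `b`. -/
def Represents (b : HilbertBasis ι ℝ H) (w : lp (fun _ : ι => H) 2) (T : H →L[ℝ] H) : Prop :=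
  ∀ i, w i = T (b i)

lemma Represents.sub {b : HilbertBasis ι ℝ H} {w w' : lp (fun _ : ι => H) 2} {T T' : H →L[ℝ] H}
    (h : Represents b w T) (h' : Represents b w' T') : Represents b (w - w') (T - T') :=
  fun i => by simp [h i, h' i]

lemma Represents.sum {κ : Type*} {b : HilbertBasis ι ℝ H} (s : Finset κ)
    {w : κ → lp (fun _ : ι => H) 2} {T : κ → H →L[ℝ] H}
    (h : ∀ k ∈ s, Represents b (w k) (T k)) :
    Represents b (∑ k ∈ s, w k) (∑ k ∈ s, T k) := fun i => by
  rw [_root_.sum_apply, lp.coeFn_sum, Finset.sum_apply]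
  exact Finset.sum_congr rfl fun k hk => h k hk i

lemma Represents.smul {b : HilbertBasis ι ℝ H} {w : lp (fun _ : ι => H) 2} {T : H →L[ℝ] H}
    (c : ℝ) (h : Represents b w T) : Represents b (c • w) (c • T) :=
  fun i => by simp [h i]

lemma represents_tens (b : HilbertBasis ι ℝ H) (x : H) :
    Represents b (tens b x x) (tensorSq x) := fun i => by
  simp [tens_apply, tensorSq, real_inner_comm]

/-- Expanding `x` in the basis and applying the functional `⟪y, T ·⟫` gives the series that defines
the left side. This is how traces of `T` against projections become inner products. -/
lemma inner_tens {b : HilbertBasis ι ℝ H} {w : lp (fun _ : ι => H) 2} {T : H →L[ℝ] H}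
    (h : Represents b w T) (x y : H) : inner ℝ (tens b x y) w = inner ℝ y (T x) := by
  refine (lp.hasSum_inner _ _).unique ?_
  have h1 := (b.hasSum_repr x).mapL ((innerSL ℝ y).comp T)
  simpa [tens_apply, h _, inner_smul_left, b.repr_apply_apply] using h1

lemma inner_tens_tens (b : HilbertBasis ι ℝ H) (x y : H) :
    inner ℝ (tens b x x) (tens b y y) = inner ℝ x y ^ 2 := by
  rw [inner_tens (represents_tens b y)]
  simp [tensorSq, inner_smul_right, real_inner_comm, sq]

lemma norm_tens_self (b : HilbertBasis ι ℝ H) (x : H) : ‖tens b x x‖ = ‖x‖ ^ 2 := by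
  rw [← sq_eq_sq₀ (norm_nonneg _) (by positivity), ← real_inner_self_eq_norm_sq,
    inner_tens_tens, real_inner_self_eq_norm_sq]

/-- `hsNorm` sums over one chosen basis; `hb` forces `b` to consist of those very vectors, so the
sum is the squared `ℓ²` norm of `w`. -/
lemma hsNorm_eq [CompleteSpace H] {b : HilbertBasis (exists_hilbertBasis ℝ H).choose ℝ H}
    (hb : ⇑b = ((↑) : (exists_hilbertBasis ℝ H).choose → H))
    {w : lp (fun _ : (exists_hilbertBasis ℝ H).choose => H) 2} {T : H →L[ℝ] H}
    (h : Represents b w T) : hsNorm T = ENNReal.ofReal ‖w‖ := by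
  have h1 : HasSum (fun i => ‖w i‖ ^ 2) (‖w‖ ^ 2) := by
    have := lp.hasSum_inner (𝕜 := ℝ) w w
    simpa only [real_inner_self_eq_norm_sq] using this
  have h2 : ∀ e : (exists_hilbertBasis ℝ H).choose,
      ‖T (e : H)‖ₑ ^ 2 = ENNReal.ofReal (‖w e‖ ^ 2) := fun e => by
    rw [ENNReal.ofReal_pow (norm_nonneg _), ofReal_norm, h e, hb]
  rw [hsNorm, tsum_congr h2, ← ENNReal.ofReal_tsum_of_nonneg (fun _ => by positivity) h1.summable,
    h1.tsum_eq, ENNReal.ofReal_rpow_of_nonneg (by positivity) (by positivity),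
    ← Real.sqrt_eq_rpow, Real.sqrt_sq (norm_nonneg _)]

end HilbertSchmidt

/-! ### The closed convex cone of compact nonnegative self-adjoint operators. -/

section Covariance

variable {H : Type*} [NormedAddCommGroup H] [InnerProductSpace ℝ H]

/-- Compact nonnegative self-adjoint operators. -/
structure IsCov (C : H →L[ℝ] H) : Prop where
  pos : C.IsPositive
  compact : IsCompactOperator C

lemma isCov_zero : IsCov (0 : H →L[ℝ] H) :=
  ⟨ContinuousLinearMap.isPositive_zero, isCompactOperator_zero⟩

lemma IsCov.add {C D : H →L[ℝ] H} (hC : IsCov C) (hD : IsCov D) : IsCov (C + D) :=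
  ⟨hC.pos.add hD.pos, hC.compact.add hD.compact⟩

lemma IsCov.smul {C : H →L[ℝ] H} (hC : IsCov C) {c : ℝ} (hc : 0 ≤ c) : IsCov (c • C) :=
  ⟨hC.pos.smul_of_nonneg hc, hC.compact.smul c⟩

lemma IsCov.sum {κ : Type*} (s : Finset κ) {C : κ → H →L[ℝ] H} (h : ∀ k ∈ s, IsCov (C k)) :
    IsCov (∑ k ∈ s, C k) :=
  Finset.sum_induction _ _ (fun _ _ => IsCov.add) isCov_zero h

lemma isCompactOperator_tensorSq (x : H) : IsCompactOperator (tensorSq x) := by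
  rw [tensorSq, InnerProductSpace.rankOne_def']
  exact (isCompactOperator_of_locallyCompactSpace_dom (innerSL ℝ x)).clm_comp
    (ContinuousLinearMap.toSpanSingleton ℝ x)

lemma isCov_tensorSq (x : H) : IsCov (tensorSq x) :=
  ⟨InnerProductSpace.isPositive_rankOne_self x, isCompactOperator_tensorSq x⟩

lemma isClosed_setOf_isCov [CompleteSpace H] : IsClosed {C : H →L[ℝ] H | IsCov C} := by
  have h : {C : H →L[ℝ] H | IsCov C} =
      {C : H →L[ℝ] H | IsCompactOperator C} ∩
        ((⋂ x, ⋂ y, {C : H →L[ℝ] H | inner ℝ (C x) y = inner ℝ x (C y)}) ∩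
          ⋂ x, {C : H →L[ℝ] H | 0 ≤ inner ℝ (C x) x}) := by
    ext C
    simp only [mem_ofPred_eq, mem_inter_iff, mem_iInter]
    refine ⟨fun h => ⟨h.compact, ?_⟩, fun h => ⟨?_, h.1⟩⟩
    · exact ⟨fun x y => h.pos.isSymmetric x y, fun x => h.pos.inner_nonneg_left x⟩
    · exact (ContinuousLinearMap.isPositive_iff C).2 ⟨fun x y => h.2.1 x y, h.2.2⟩
  rw [h]
  refine isClosed_setOfPred_isCompactOperator.inter (IsClosed.inter ?_ ?_)
  · exact isClosed_iInter fun x => isClosed_iInter fun y =>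
      isClosed_eq (by fun_prop) (by fun_prop)
  · exact isClosed_iInter fun x => isClosed_le (by fun_prop) (by fun_prop)

/-- A closed convex set contains the averages of its elements. If `F` is not integrable, the
integral is `0`, which is also in the cone. -/
lemma isCov_integral [CompleteSpace H] {Ω : Type*} [MeasurableSpace Ω] {P : Measure Ω}
    [IsProbabilityMeasure P] {F : Ω → H →L[ℝ] H} (hF : ∀ ω, IsCov (F ω)) :
    IsCov (∫ ω, F ω ∂P) := by
  by_cases hi : Integrable F P
  · refine Convex.integral_mem (s := {C : H →L[ℝ] H | IsCov C}) ?_ isClosed_setOf_isCov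
      (ae_of_all _ hF) hi
    exact fun C hC D hD a b ha hb _ => (IsCov.smul hC ha).add (IsCov.smul hD hb)
  · rw [integral_undef hi]
    exact isCov_zero

end Covariance

/-! ### Variational bounds for eigenvalues and perturbation of leading eigenspaces. -/

section Spectral

variable {H : Type*} [NormedAddCommGroup H] [InnerProductSpace ℝ H]

lemma bddAbove_eigenvalue (C : H →L[ℝ] H) (j : ℕ) :
    BddAbove {r : ℝ | 0 ≤ r ∧ ∃ v : Fin (j + 1) → H, Orthonormal ℝ v ∧
      ∀ i, ∃ c : ℝ, r ≤ c ∧ C (v i) = c • v i} := by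
  refine ⟨‖C‖, ?_⟩
  rintro r ⟨-, v, hv, h⟩
  obtain ⟨c, hc, hcv⟩ := h 0
  have h1 : ‖C (v 0)‖ ≤ ‖C‖ * ‖v 0‖ := C.le_opNorm _
  rw [hcv, norm_smul, hv.1 0, mul_one, mul_one] at h1
  exact hc.trans ((le_abs_self c).trans h1)

lemma le_eigenvalue {C : H →L[ℝ] H} {j : ℕ} {r : ℝ} (hr : 0 ≤ r) {v : Fin (j + 1) → H}
    (hv : Orthonormal ℝ v) (h : ∀ i, ∃ c : ℝ, r ≤ c ∧ C (v i) = c • v i) :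
    r ≤ eigenvalue C (j + 1) :=
  le_csSup (bddAbove_eigenvalue C j) ⟨hr, v, hv, h⟩

lemma eigenvalue_nonneg (C : H →L[ℝ] H) (j : ℕ) : 0 ≤ eigenvalue C j :=
  Real.sSup_nonneg fun _ h => h.1

lemma eigenvalue_succ_le (C : H →L[ℝ] H) (j : ℕ) :
    eigenvalue C (j + 2) ≤ eigenvalue C (j + 1) := by
  refine Real.sSup_le ?_ (eigenvalue_nonneg C _)
  rintro r ⟨hr, v, hv, h⟩
  exact le_eigenvalue hr (hv.comp Fin.castSucc (Fin.castSucc_injective _)) fun i => h _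

lemma eigenvalue_antitone (C : H →L[ℝ] H) : Antitone fun j => eigenvalue C (j + 1) :=
  antitone_nat_of_succ_le (eigenvalue_succ_le C)

/-- Fredholm alternative: otherwise `‖T‖` lies in the resolvent set, which keeps the Rayleigh
quotient below `‖T‖ - ε`. For a positive operator its supremum is `‖T‖`. -/
lemma hasEigenvalue_norm [CompleteSpace H] {T : H →L[ℝ] H} (hT : IsCov T) (h0 : T ≠ 0) :
    Module.End.HasEigenvalue (T : Module.End ℝ H) ‖T‖ := by
  have hne : ‖T‖ ≠ 0 := norm_ne_zero_iff.2 h0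
  refine (IsCompactOperator.hasEigenvalue_or_mem_resolventSet hT.compact hne).resolve_right ?_
  intro hres
  have : Nontrivial H := by
    by_contra hH
    rw [not_nontrivial_iff_subsingleton] at hH
    exact h0 (Subsingleton.elim _ _)
  obtain ⟨ε, hε, h⟩ := T.rayleighQuotient_le_of_norm_mem_resolventSet (𝕜 := ℝ) hres
  have h1 : ‖T‖ ≤ ‖T‖ - ε := by
    nth_rewrite 1 [T.norm_eq_iSup_rayleighQuotient hT.pos.isSymmetric]
    refine ciSup_le fun x => ?_
    rw [abs_of_nonneg]
    · exact h x
    · exact div_nonneg (hT.pos.inner_nonneg_left x) (by positivity)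
  linarith

/-- The quadratic form of `C` is bounded by `λ_{p+1}` on the orthogonal complement of `p`
leading eigenvectors. -/
lemma inner_le_eigenvalue [CompleteSpace H] {C : H →L[ℝ] H} (hC : IsCov C) {p : ℕ} {φ : Fin p → H}
    (hφ : Orthonormal ℝ φ) (hCφ : ∀ j, C (φ j) = eigenvalue C (j + 1) • φ j) {x : H}
    (hx : ∀ j, inner ℝ (φ j) x = 0) :
    inner ℝ (C x) x ≤ eigenvalue C (p + 1) * ‖x‖ ^ 2 := by
  -- Deflation: `B` kills every `φ j` and agrees with `C` on their orthogonal complement, so it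
  -- suffices to bound `‖B‖`.
  set B : H →L[ℝ] H := C - ∑ j : Fin p, eigenvalue C (j + 1) • tensorSq (φ j) with hB
  have hBx : ∀ z, B z = C z - ∑ j : Fin p, (eigenvalue C (j + 1) * inner ℝ (φ j) z) • φ j := fun z => by
    simp [hB, tensorSq, _root_.sum_apply, mul_smul]
  have hBφ : ∀ j, B (φ j) = 0 := fun j => by
    rw [hBx, hCφ]
    simp [orthonormal_iff_ite.1 hφ]
  have hsymm : ∀ y z, inner ℝ (B y) z = inner ℝ y (B z) := fun y z => by
    rw [hBx, hBx, inner_sub_left, inner_sub_right, hC.pos.inner_left_eq_inner_right, sum_inner,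
      inner_sum]
    congr 1
    refine Finset.sum_congr rfl fun j _ => ?_
    rw [inner_smul_left, inner_smul_right, real_inner_comm y (φ j)]
    simp only [RCLike.conj_to_real]
    ring
  have hBorth : ∀ y j, inner ℝ (φ j) (B y) = 0 := fun y j => by
    rw [← hsymm, hBφ, inner_zero_left]
  have hBcov : IsCov B := by
    refine ⟨(ContinuousLinearMap.isPositive_iff B).2 ⟨fun y z => hsymm y z, fun z => ?_⟩, ?_⟩
    · set u := z - ∑ j, inner ℝ (φ j) z • φ j with hu
      have hBu : B u = B z := by simp [hu, map_sum, hBφ]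
      have hul : ∀ j, inner ℝ (φ j) u = 0 := fun j => by
        rw [hu, inner_sub_right, hφ.inner_right_fintype, sub_self]
      have hCu : B u = C u := by rw [hBx]; simp [hul]
      have h1 : inner ℝ (B z) z = inner ℝ (C u) u := by
        have h2 : inner ℝ (B u) (∑ j, inner ℝ (φ j) z • φ j) = 0 := by
          rw [inner_sum]
          exact Finset.sum_eq_zero fun j _ => by
            rw [inner_smul_right, real_inner_comm (φ j) (B u), hBorth, mul_zero]
        have hz : z = u + ∑ j, inner ℝ (φ j) z • φ j := by rw [hu]; abel
        rw [← hCu, ← hBu]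
        nth_rewrite 1 [hz]
        rw [inner_add_right, h2, add_zero]
      rw [h1]
      exact hC.pos.inner_nonneg_left u
    · refine hC.compact.sub ?_
      exact (IsCov.sum Finset.univ fun j _ =>
        (isCov_tensorSq (φ j)).smul (eigenvalue_nonneg C (j + 1))).compact
  have hCx : C x = B x := by rw [hBx]; simp [hx]
  have key : ‖B‖ ≤ eigenvalue C (p + 1) := by
    by_cases h0 : B = 0
    · rw [h0, norm_zero]
      exact eigenvalue_nonneg C _
    have hm : 0 < ‖B‖ := norm_pos_iff.2 h0
    obtain ⟨w, hw⟩ := (hasEigenvalue_norm hBcov h0).exists_hasEigenvector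
    have hBw : B w = ‖B‖ • w := hw.apply_eq_smul
    have hw0 : w ≠ 0 := hw.2
    have horth : ∀ j, inner ℝ (φ j) w = 0 := fun j => by
      have := hBorth w j
      rw [hBw, inner_smul_right] at this
      exact (mul_eq_zero.1 this).resolve_left hm.ne'
    have hCw : C w = ‖B‖ • w := by rw [← hBw, hBx]; simp [horth]
    set v := ‖w‖⁻¹ • w with hv
    have hv1 : ‖v‖ = 1 := norm_smul_inv_norm hw0
    have hCv : C v = ‖B‖ • v := by rw [hv, map_smul, hCw, smul_comm]
    have hvφ : ∀ j, inner ℝ (φ j) v = 0 := fun j => by rw [hv, inner_smul_right, horth, mul_zero]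
    -- The top eigenvector `v` of `B` is also one of `C`, orthogonal to all `φ j`. Adjoining it to
    -- the first `i` of them gives `i + 1` competitors for `λ_{i+1}`; that these `i` have
    -- eigenvalues at least `‖B‖` is the induction hypothesis.
    have main : ∀ i, i ≤ p → ‖B‖ ≤ eigenvalue C (i + 1) := by
      intro i
      induction i using Nat.strong_induction_on with
      | _ i ih =>
        intro hi
        refine le_eigenvalue (v := Fin.cons v fun j : Fin i => φ (j.castLE hi)) hm.le ?_ ?_
        · rw [orthonormal_iff_ite]
          intro a c
          refine Fin.cases ?_ (fun a => ?_) a <;> refine Fin.cases ?_ (fun c => ?_) c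
          · simp [hv1]
          · simp [real_inner_comm, hvφ, (Fin.succ_ne_zero c).symm]
          · simp [hvφ]
          · simp [orthonormal_iff_ite.1 hφ, Fin.ext_iff]
        · intro a
          refine Fin.cases ?_ (fun a => ?_) a
          · exact ⟨‖B‖, le_rfl, by simpa using hCv⟩
          · refine ⟨eigenvalue C (a + 1), ih a a.2 (a.2.le.trans hi), ?_⟩
            simpa using hCφ (a.castLE hi)
    exact main p le_rfl
  calc inner ℝ (C x) x ≤ ‖C x‖ * ‖x‖ := real_inner_le_norm _ _
    _ ≤ (‖B‖ * ‖x‖) * ‖x‖ := by rw [hCx]; gcongr; exact B.le_opNorm x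
    _ = ‖B‖ * ‖x‖ ^ 2 := by ring
    _ ≤ _ := by gcongr

/-- Split `ψ l` into its part in the span of the `φ j` and a remainder `r`. The span is invariant,
so cross terms vanish, and `r` contributes at most `λ_{p+1} ‖r‖²`. After summing over `l`, the trace
difference is at least `∑ (λ_j - λ_{p+1}) (1 - q j)`. Bessel's inequality gives `q j ≤ 1`, which
allows each `λ_j` to be lowered to `λ_p`. -/
lemma trace_sub_trace_ge [CompleteSpace H] {C : H →L[ℝ] H} (hC : IsCov C) {p : ℕ} (hp : 1 ≤ p)
    {φ ψ : Fin p → H} (hφ : Orthonormal ℝ φ) (hCφ : ∀ j, C (φ j) = eigenvalue C (j + 1) • φ j)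
    (hψ : Orthonormal ℝ ψ) :
    (eigenvalue C p - eigenvalue C (p + 1)) * (p - ∑ j, ∑ l, inner ℝ (φ j) (ψ l) ^ 2) ≤
      ∑ j, inner ℝ (φ j) (C (φ j)) - ∑ l, inner ℝ (ψ l) (C (ψ l)) := by
  set q : Fin p → ℝ := fun j => ∑ l, inner ℝ (φ j) (ψ l) ^ 2 with hq
  have hq1 : ∀ j, q j ≤ 1 := fun j => by
    have := hψ.sum_inner_products_le (φ j) (s := Finset.univ)
    rw [hφ.1 j] at this
    simpa [hq, real_inner_comm] using this
  have hl : ∀ l, inner ℝ (ψ l) (C (ψ l)) ≤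
      ∑ j : Fin p, eigenvalue C (j + 1) * inner ℝ (φ j) (ψ l) ^ 2 +
        eigenvalue C (p + 1) * (1 - ∑ j, inner ℝ (φ j) (ψ l) ^ 2) := by
    intro l
    set u := ∑ j, inner ℝ (φ j) (ψ l) • φ j with hu
    set r := ψ l - u with hr
    have hrφ : ∀ j, inner ℝ (φ j) r = 0 := fun j => by
      rw [hr, inner_sub_right, hu, hφ.inner_right_fintype, sub_self]
    have hru : inner ℝ u r = 0 := by
      rw [hu, sum_inner]; simp [inner_smul_left, hrφ]
    have hψu : ψ l = u + r := by rw [hr]; abel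
    have hCu : C u = ∑ j, (inner ℝ (φ j) (ψ l) * eigenvalue C (j + 1)) • φ j := by
      simp [hu, map_sum, hCφ, smul_smul]
    have hCur : inner ℝ (C u) r = 0 := by
      rw [hCu, sum_inner]; simp [inner_smul_left, hrφ]
    have huu : inner ℝ u u = ∑ j, inner ℝ (φ j) (ψ l) ^ 2 := by
      rw [hu, hφ.inner_sum]; simp [sq]
    have hCuu : inner ℝ u (C u) = ∑ j : Fin p, eigenvalue C (j + 1) * inner ℝ (φ j) (ψ l) ^ 2 := by
      rw [hCu, hu, hφ.inner_sum]
      refine Finset.sum_congr rfl fun j _ => ?_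
      simp only [RCLike.conj_to_real]
      ring
    have hnr : ‖r‖ ^ 2 = 1 - ∑ j, inner ℝ (φ j) (ψ l) ^ 2 := by
      have h1 : ‖ψ l‖ ^ 2 = ‖u‖ ^ 2 + ‖r‖ ^ 2 := by
        rw [hψu, norm_add_sq_real, hru]; ring
      rw [hψ.1 l, ← real_inner_self_eq_norm_sq u, huu] at h1
      linarith
    have h2 := inner_le_eigenvalue hC hφ hCφ hrφ
    rw [hnr] at h2
    have h3 : inner ℝ (ψ l) (C (ψ l)) = inner ℝ u (C u) + inner ℝ (C r) r := by
      rw [hψu, map_add, inner_add_left, inner_add_right, inner_add_right,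
        ← hC.pos.inner_left_eq_inner_right u r, hCur, real_inner_comm (C u) r, hCur,
        real_inner_comm r (C r)]
      ring
    rw [h3, hCuu]
    linarith
  have hsum := Finset.sum_le_sum fun l (_ : l ∈ Finset.univ) => hl l
  rw [Finset.sum_add_distrib, Finset.sum_comm, ← Finset.mul_sum, Finset.sum_sub_distrib,
    Finset.sum_comm (f := fun l j => inner ℝ (φ j) (ψ l) ^ 2)] at hsum
  simp only [← Finset.mul_sum] at hsum
  have hφC : ∀ j, inner ℝ (φ j) (C (φ j)) = eigenvalue C (j + 1) := fun j => by
    rw [hCφ, inner_smul_right, real_inner_self_eq_norm_sq, hφ.1 j]; ring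
  have hge : ∑ j, eigenvalue C p * (1 - q j) ≤ ∑ j, eigenvalue C ((j : Fin p) + 1) * (1 - q j) := by
    refine Finset.sum_le_sum fun j _ => mul_le_mul_of_nonneg_right ?_ (by linarith [hq1 j])
    obtain ⟨m, rfl⟩ : ∃ m, p = m + 1 := ⟨p - 1, by omega⟩
    exact eigenvalue_antitone C (by omega : (j : ℕ) ≤ m)
  simp only [hφC]
  rw [← Finset.mul_sum] at hge
  simp only [mul_sub, mul_one, Finset.sum_sub_distrib] at hge hsum ⊢
  simp only [Finset.sum_const, Finset.card_univ, Fintype.card_fin, nsmul_eq_mul, mul_one] at hge hsum ⊢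
  simp only [hq] at *
  nlinarith

lemma starProjection_span_orthonormal {p : ℕ} {φ : Fin p → H} (hφ : Orthonormal ℝ φ)
    {V : Submodule ℝ H} [FiniteDimensional ℝ V] (hV : V = Submodule.span ℝ (Set.range φ)) :
    V.starProjection = ∑ j, tensorSq (φ j) := by
  ext x
  simp only [_root_.sum_apply, tensorSq, InnerProductSpace.rankOne_apply]
  refine (Submodule.eq_starProjection_of_mem_of_inner_eq_zero ?_ ?_)
  · rw [hV]
    exact Submodule.sum_mem _ fun j _ =>
      Submodule.smul_mem _ _ (Submodule.subset_span (mem_range_self j))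
  · intro w hw
    rw [hV] at hw
    induction hw using Submodule.span_induction with
    | mem y hy =>
      obtain ⟨j, rfl⟩ := hy
      rw [real_inner_comm, inner_sub_right, hφ.inner_right_fintype, sub_self]
    | zero => simp
    | add y z _ _ hy hz => rw [inner_add_right, hy, hz, add_zero]
    | smul c y _ hy => rw [inner_smul_right, hy, mul_zero]

/-- Perturbation bound for leading eigenspaces in Hilbert-Schmidt norm. -/
lemma rho_le_of_represents [CompleteSpace H]
    {b : HilbertBasis (exists_hilbertBasis ℝ H).choose ℝ H}
    (hb : ⇑b = ((↑) : (exists_hilbertBasis ℝ H).choose → H))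
    {A B : H →L[ℝ] H} (hA : IsCov A) (hB : IsCov B)
    {wA wB : lp (fun _ : (exists_hilbertBasis ℝ H).choose => H) 2}
    (hwA : Represents b wA A) (hwB : Represents b wB B) {p : ℕ} (hp : 1 ≤ p)
    (hgap : 0 < eigengap A p) {W V : Submodule ℝ H} [FiniteDimensional ℝ W]
    [FiniteDimensional ℝ V] (hW : IsLeadingEigenspace B p W) (hV : IsLeadingEigenspace A p V) :
    rho W V ≤ ENNReal.ofReal (‖wB - wA‖ / eigengap A p) := by
  obtain ⟨φ, hφ, hAφ, hVφ⟩ := hV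
  obtain ⟨ψ, hψ, hBψ, hWψ⟩ := hW
  set wV := ∑ j, tens b (φ j) (φ j) with hwV
  set wW := ∑ j, tens b (ψ j) (ψ j) with hwW
  have hrepV : Represents b wV V.starProjection := by
    rw [starProjection_span_orthonormal hφ hVφ]
    exact Represents.sum _ fun j _ => represents_tens b (φ j)
  have hrepW : Represents b wW W.starProjection := by
    rw [starProjection_span_orthonormal hψ hWψ]
    exact Represents.sum _ fun j _ => represents_tens b (ψ j)
  rw [rho, hsNorm_eq hb (hrepW.sub hrepV)]
  refine ENNReal.ofReal_le_ofReal ?_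
  set s := ∑ j, ∑ l, inner ℝ (φ j) (ψ l) ^ 2 with hs
  have hVW : inner ℝ wV wW = s := by
    simp only [hwV, hwW, sum_inner, inner_sum, inner_tens_tens, hs]
    exact Finset.sum_comm
  have hself : ∀ χ : Fin p → H, Orthonormal ℝ χ →
      ‖∑ j, tens b (χ j) (χ j)‖ ^ 2 = (p : ℝ) := fun χ hχ => by
    rw [← real_inner_self_eq_norm_sq]
    simp only [sum_inner, inner_sum, inner_tens_tens, orthonormal_iff_ite.1 hχ]
    simp
  have hnorm : ‖wW - wV‖ ^ 2 = 2 * (p - s) := by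
    rw [norm_sub_sq_real, hself φ hφ, hself ψ hψ, real_inner_comm, hVW]
    ring
  have hV1 : ∀ {w T}, Represents b w T → inner ℝ wV w = ∑ j, inner ℝ (φ j) (T (φ j)) :=
    fun {w T} h => by simp only [hwV, sum_inner, inner_tens h]
  have hW1 : ∀ {w T}, Represents b w T → inner ℝ wW w = ∑ j, inner ℝ (ψ j) (T (ψ j)) :=
    fun {w T} h => by simp only [hwW, sum_inner, inner_tens h]
  have h1 := trace_sub_trace_ge hA hp hφ hAφ hψ
  rw [← hV1 hwA, ← hW1 hwA, ← hs] at h1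
  have h2 := trace_sub_trace_ge hB hp hψ hBψ hφ
  rw [← hV1 hwB, ← hW1 hwB, Finset.sum_comm] at h2
  simp only [real_inner_comm (φ _) (ψ _)] at h2
  rw [← hs] at h2
  have hps : 0 ≤ (p : ℝ) - s := by nlinarith [sq_nonneg ‖wW - wV‖]
  -- For `B` only the ordering of the eigenvalues is used, so its leading eigenspace need not be
  -- unique.
  have h3 : 0 ≤ (eigenvalue B p - eigenvalue B (p + 1)) * (p - s) := by
    refine mul_nonneg (sub_nonneg.2 ?_) hps
    obtain ⟨m, rfl⟩ : ∃ m, p = m + 1 := ⟨p - 1, by omega⟩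
    exact eigenvalue_succ_le B m
  have h4 : eigengap A p * ‖wW - wV‖ ^ 2 ≤ ‖wB - wA‖ * ‖wW - wV‖ := by
    have h5 : inner ℝ (wW - wV) (wB - wA) ≤ ‖wW - wV‖ * ‖wB - wA‖ := real_inner_le_norm _ _
    simp only [inner_sub_left, inner_sub_right] at h5
    rw [hnorm, eigengap]
    nlinarith
  rw [le_div_iff₀ hgap]
  rcases eq_or_lt_of_le (norm_nonneg (wW - wV)) with h0 | h0
  · rw [← h0]; simp
  · have : (eigengap A p * ‖wW - wV‖) * ‖wW - wV‖ ≤ ‖wB - wA‖ * ‖wW - wV‖ := by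
      rw [mul_assoc, ← sq]; exact h4
    linarith [le_of_mul_le_mul_right this h0]

end Spectral

/-! ### Bernstein's inequality in a Hilbert space, through the moment `E cosh ‖S‖`. -/

section Bernstein

lemma hasSum_cosh_sqrt {x : ℝ} (hx : 0 ≤ x) :
    HasSum (fun n : ℕ => x ^ n / (Nat.factorial (2 * n) : ℝ)) (Real.cosh √x) := by
  have h := Real.hasSum_cosh √x
  simpa only [pow_mul, Real.sq_sqrt hx] using h

lemma convexOn_cosh_sqrt : ConvexOn ℝ (Ici 0) fun x => Real.cosh √x := by
  refine ⟨convex_Ici 0, fun x hx y hy a b ha hb hab => ?_⟩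
  have hxy : 0 ≤ a • x + b • y := add_nonneg (mul_nonneg ha hx) (mul_nonneg hb hy)
  refine hasSum_le (fun n => ?_) (hasSum_cosh_sqrt hxy)
    (((hasSum_cosh_sqrt hx).mul_left a).add ((hasSum_cosh_sqrt hy).mul_left b))
  have h := (convexOn_pow n).2 hx hy ha hb hab
  calc (a • x + b • y) ^ n / (Nat.factorial (2 * n) : ℝ)
      ≤ (a • x ^ n + b • y ^ n) / (Nat.factorial (2 * n) : ℝ) := by gcongr
    _ = _ := by simp only [smul_eq_mul]; ring

/-- With `κ` the cosine of the angle between `s` and `z`, `‖s + z‖²` is the mean of `(a + b)²` and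
`(a - b)²` with weights `(1 ± κ)/2`. Convexity of `cosh √·` then gives `cosh a cosh b + κ sinh a
sinh b`. The term linear in `z` is isolated because it averages to zero for centred `z`. -/
lemma cosh_norm_add_le {E : Type*} [NormedAddCommGroup E] [InnerProductSpace ℝ E] (s z : E) :
    Real.cosh ‖s + z‖ ≤ Real.cosh ‖s‖ + inner ℝ ((Real.sinh ‖s‖ / ‖s‖) • s) z
      + Real.cosh ‖s‖ * (Real.exp ‖z‖ - 1 - ‖z‖) := by
  set a := ‖s‖
  set b := ‖z‖
  have ha : 0 ≤ a := norm_nonneg _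
  have hb : 0 ≤ b := norm_nonneg _
  obtain ⟨κ, hκ1, hκ2, hκ⟩ : ∃ κ : ℝ, -1 ≤ κ ∧ κ ≤ 1 ∧ inner ℝ s z = κ * (a * b) := by
    have h := abs_le.1 (abs_real_inner_le_norm s z)
    rcases eq_or_lt_of_le (mul_nonneg ha hb) with h0 | h0
    · refine ⟨0, by norm_num, by norm_num, ?_⟩
      have h1 : inner ℝ s z ≤ a * b := h.2
      have h2 : -(a * b) ≤ inner ℝ s z := h.1
      linarith
    · exact ⟨inner ℝ s z / (a * b), by rw [le_div_iff₀ h0]; linarith [h.1],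
        by rw [div_le_iff₀ h0]; linarith [h.2], (div_mul_cancel₀ _ h0.ne').symm⟩
  have h1 : ‖s + z‖ = √(((1 + κ) / 2) * (a + b) ^ 2 + ((1 - κ) / 2) * (a - b) ^ 2) := by
    rw [← Real.sqrt_sq (norm_nonneg (s + z)), norm_add_sq_real, hκ]
    congr 1
    ring
  have h2 := convexOn_cosh_sqrt.2 (mem_Ici.2 (sq_nonneg (a + b))) (mem_Ici.2 (sq_nonneg (a - b)))
    (by linarith : 0 ≤ (1 + κ) / 2) (by linarith : 0 ≤ (1 - κ) / 2) (by ring)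
  simp only [smul_eq_mul] at h2
  rw [← h1] at h2
  simp only [Real.sqrt_sq_eq_abs, Real.cosh_abs, Real.cosh_add, Real.cosh_sub] at h2
  have h3 : inner ℝ ((Real.sinh a / a) • s) z = κ * b * Real.sinh a := by
    rw [inner_smul_left, hκ]
    rcases eq_or_lt_of_le ha with h0 | h0
    · simp [← h0]
    · simp only [RCLike.conj_to_real]; field_simp
  rw [h3, ← Real.cosh_add_sinh b]
  have h4 : 0 ≤ Real.sinh b - b := sub_nonneg.2 (Real.self_le_sinh_iff.2 hb)
  have h5 : κ * Real.sinh a ≤ Real.cosh a := by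
    have := Real.sinh_lt_cosh a
    have := Real.sinh_nonneg_iff.2 ha
    nlinarith
  nlinarith [mul_le_mul_of_nonneg_right h5 h4]

/-- Termwise comparison with a geometric series, from `2 * 3 ^ n ≤ (n + 2)!`. -/
lemma exp_sub_one_sub_id_le {x : ℝ} (hx : 0 ≤ x) (hx3 : x < 3) :
    Real.exp x - 1 - x ≤ x ^ 2 / (2 * (1 - x / 3)) := by
  have h := NormedSpace.expSeries_div_hasSum_exp (𝔸 := ℝ) x
  rw [← Real.exp_eq_exp_ℝ] at h
  have h1 := (hasSum_nat_add_iff' 2).2 h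
  have h2 := (hasSum_geometric_of_lt_one (by positivity) (by linarith : x / 3 < 1)).mul_left
    (x ^ 2 / 2)
  have h3 := hasSum_le (fun n => ?_) h1 h2
  · simp only [Finset.sum_range_succ, Finset.sum_range_zero] at h3
    have hne : 1 - x / 3 ≠ 0 := by linarith
    calc Real.exp x - 1 - x = Real.exp x - (0 + x ^ 0 / (Nat.factorial 0 : ℝ) +
          x ^ 1 / (Nat.factorial 1 : ℝ)) := by simp; ring
      _ ≤ _ := h3
      _ = _ := by field_simp
  · have h4 : ((2 * 3 ^ n : ℕ) : ℝ) ≤ (Nat.factorial (n + 2) : ℝ) := by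
      have := @Nat.factorial_mul_pow_le_factorial 2 n
      rw [add_comm n 2]
      exact_mod_cast this
    push_cast at h4
    calc x ^ (n + 2) / (Nat.factorial (n + 2) : ℝ) ≤ x ^ (n + 2) / (2 * 3 ^ n) := by gcongr
      _ = _ := by rw [div_pow, pow_add]; field_simp

variable {Ω 𝓧 E κ : Type*} [MeasurableSpace Ω] [MeasurableSpace 𝓧] [NormedAddCommGroup E]
  [InnerProductSpace ℝ E] [CompleteSpace E] {P : Measure Ω} [IsProbabilityMeasure P]

/-- Each new summand is independent of the previous ones and centred, so the linear term of
`cosh_norm_add_le` integrates to zero and the moment grows by at most the factor `1 + c`. -/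
lemma integral_cosh_norm_sum_le {Y : κ → Ω → 𝓧} {ν : Measure 𝓧}
    (hYm : ∀ i, AEMeasurable (Y i) P) (hY : iIndepFun Y P) (hν : ∀ i, P.map (Y i) = ν)
    {ξ : 𝓧 → E} (hξ : StronglyMeasurable ξ) {B : ℝ} (hB : ∀ x, ‖ξ x‖ ≤ B)
    (h0 : ∫ x, ξ x ∂ν = 0) (s : Finset κ) :
    ∫ ω, Real.cosh ‖∑ i ∈ s, ξ (Y i ω)‖ ∂P ≤
      (1 + ∫ x, (Real.exp ‖ξ x‖ - 1 - ‖ξ x‖) ∂ν) ^ s.card := by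
  classical
  set c := ∫ x, (Real.exp ‖ξ x‖ - 1 - ‖ξ x‖) ∂ν with hc
  have hnb : ∀ (t : Finset κ) (u : t → 𝓧), ‖∑ j, ξ (u j)‖ ≤ t.card * B := fun t u => by
    refine (norm_sum_le_of_le _ fun j _ => hB (u j)).trans ?_
    simp
  induction s using Finset.induction_on with
  | empty => simp
  | insert i s hi ih =>
    have hνp : IsProbabilityMeasure ν := hν i ▸ Measure.isProbabilityMeasure_map (hYm i)
    set X : Ω → s → 𝓧 := fun ω j => Y j ω with hX
    have hXm : AEMeasurable X P := aemeasurable_pi_lambda _ fun j => hYm j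
    have hind : IndepFun X (Y i) P := by
      have h := hY.indepFun_finset₀ s {i} (by simpa using hi) hYm
      exact h.comp measurable_id (measurable_pi_apply (⟨i, by simp⟩ : ({i} : Finset κ)))
    have : IsProbabilityMeasure (P.map X) := Measure.isProbabilityMeasure_map hXm
    set T : (s → 𝓧) → E := fun u => ∑ j, ξ (u j) with hT
    have hTm : StronglyMeasurable T :=
      Finset.stronglyMeasurable_fun_sum _ fun j _ => hξ.comp_measurable (measurable_pi_apply j)
    have hTX : ∀ ω, T (X ω) = ∑ j ∈ s, ξ (Y j ω) := fun ω =>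
      Finset.sum_coe_sort s fun j => ξ (Y j ω)
    set F : (s → 𝓧) → E := fun u => (Real.sinh ‖T u‖ / ‖T u‖) • T u with hF
    have hFm : StronglyMeasurable F := by
      refine StronglyMeasurable.smul (Measurable.stronglyMeasurable ?_) hTm
      have := hTm.norm.measurable
      fun_prop
    have hFb : ∀ u, ‖F u‖ ≤ Real.sinh (s.card * B) := fun u => by
      refine le_trans ?_ (Real.sinh_le_sinh.2 (hnb s u))
      rw [hF, norm_smul, norm_div, norm_norm, Real.norm_eq_abs,
        abs_of_nonneg (Real.sinh_nonneg_iff.2 (norm_nonneg _))]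
      rcases eq_or_ne ‖T u‖ 0 with h | h
      · simp [h]
      · exact (div_mul_cancel₀ _ h).le
    have hFi : Integrable F (P.map X) :=
      Integrable.of_bound hFm.aestronglyMeasurable (Real.sinh (s.card * B)) (ae_of_all _ hFb)
    have hξi : Integrable ξ ν := Integrable.of_bound hξ.aestronglyMeasurable B (ae_of_all _ hB)
    have hCm : StronglyMeasurable fun u => Real.cosh ‖T u‖ :=
      Real.continuous_cosh.comp_stronglyMeasurable hTm.norm
    have hcosh : ∀ {r R : ℝ}, 0 ≤ r → r ≤ R → Real.cosh r ≤ Real.cosh R := fun h1 h2 =>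
      Real.cosh_le_cosh.2 (by rwa [abs_of_nonneg h1, abs_of_nonneg (h1.trans h2)])
    have hCi : Integrable (fun u => Real.cosh ‖T u‖) (P.map X) := by
      refine Integrable.of_bound hCm.aestronglyMeasurable (Real.cosh (s.card * B))
        (ae_of_all _ fun u => ?_)
      rw [Real.norm_eq_abs, abs_of_pos (Real.cosh_pos _)]
      exact hcosh (norm_nonneg _) (hnb s u)
    set G : 𝓧 → ℝ := fun x => Real.exp ‖ξ x‖ - 1 - ‖ξ x‖ with hG
    have hGm : StronglyMeasurable G :=
      ((Real.continuous_exp.comp_stronglyMeasurable hξ.norm).sub stronglyMeasurable_const).sub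
        hξ.norm
    have hGi : Integrable G ν := by
      refine Integrable.of_bound hGm.aestronglyMeasurable (Real.exp B) (ae_of_all _ fun x => ?_)
      have h1 := Real.add_one_le_exp ‖ξ x‖
      have h2 := Real.exp_le_exp.2 (hB x)
      rw [Real.norm_eq_abs, abs_of_nonneg (by simp only [hG]; linarith)]
      simp only [hG]
      linarith [norm_nonneg (ξ x)]
    have hlin : ∫ ω, inner ℝ (F (X ω)) (ξ (Y i ω)) ∂P = 0 := by
      have h : ∫ ω, inner ℝ (F (X ω)) (ξ (Y i ω)) ∂P =
          inner ℝ (∫ ω, F (X ω) ∂P) (∫ ω, ξ (Y i ω) ∂P) :=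
        hind.integral_bilin_comp_comp hXm (hYm i) hFi (by rwa [hν i]) (innerSL ℝ)
      rw [h, ← integral_map (hYm i) (by rw [hν i]; exact hξ.aestronglyMeasurable), hν i, h0,
        inner_zero_right]
    have hquad : ∫ ω, Real.cosh ‖T (X ω)‖ * G (Y i ω) ∂P =
        (∫ ω, Real.cosh ‖T (X ω)‖ ∂P) * c := by
      have h := hind.integral_bilin_comp_comp hXm (hYm i) hCi (by rwa [hν i])
        (ContinuousLinearMap.mul ℝ ℝ)
      simp only [ContinuousLinearMap.mul_apply'] at h
      rw [h, ← integral_map (f := G) (hYm i) (by rw [hν i]; exact hGm.aestronglyMeasurable), hν i]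
    have hC' : Integrable (fun ω => Real.cosh ‖T (X ω)‖) P := hCi.comp_aemeasurable hXm
    have hI1 : Integrable (fun ω => inner ℝ (F (X ω)) (ξ (Y i ω))) P := by
      refine Integrable.of_bound ?_ (Real.sinh (s.card * B) * B) (ae_of_all _ fun ω => ?_)
      · exact (hFm.aestronglyMeasurable.comp_aemeasurable hXm).inner
          (hξ.aestronglyMeasurable.comp_aemeasurable (hYm i))
      · refine (norm_inner_le_norm _ _).trans ?_
        exact mul_le_mul (hFb _) (hB _) (norm_nonneg _)
          (Real.sinh_nonneg_iff.2 ((norm_nonneg _).trans (hnb s (X ω))))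
    have hI2 : Integrable (fun ω => Real.cosh ‖T (X ω)‖ * G (Y i ω)) P := by
      refine (hind.comp (φ := fun u => Real.cosh ‖T u‖) (ψ := G) hCm.measurable
        hGm.measurable).integrable_mul hC' ?_
      exact Integrable.comp_aemeasurable (by rwa [hν i]) (hYm i)
    have hstep : ∫ ω, Real.cosh ‖∑ j ∈ insert i s, ξ (Y j ω)‖ ∂P ≤
        ∫ ω, (Real.cosh ‖T (X ω)‖ + inner ℝ (F (X ω)) (ξ (Y i ω)) +
          Real.cosh ‖T (X ω)‖ * G (Y i ω)) ∂P := by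
      refine integral_mono_of_nonneg (ae_of_all _ fun ω => (Real.cosh_pos _).le)
        ((hC'.add hI1).add hI2) (ae_of_all _ fun ω => ?_)
      simp only [Finset.sum_insert hi, add_comm (ξ (Y i ω)), ← hTX]
      exact cosh_norm_add_le _ _
    rw [integral_add (by exact hC'.add hI1) hI2, integral_add hC' hI1, hlin, hquad, add_zero] at hstep
    simp only [hTX] at hstep
    have hc0 : 0 ≤ 1 + c := by
      have : 0 ≤ c := integral_nonneg fun x => by
        have := Real.add_one_le_exp ‖ξ x‖
        simp only [Pi.zero_apply]
        linarith
      linarith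
    rw [Finset.card_insert_of_notMem hi, pow_succ]
    calc _ ≤ _ := hstep
      _ = (∫ ω, Real.cosh ‖∑ j ∈ s, ξ (Y j ω)‖ ∂P) * (1 + c) := by ring
      _ ≤ _ := by gcongr

/-- Bernstein's inequality for sums of bounded centred i.i.d. random elements of a Hilbert
space. -/
theorem bernstein_hilbert [Fintype κ] {Y : κ → Ω → 𝓧} {ν : Measure 𝓧} [IsProbabilityMeasure ν]
    (hYm : ∀ i, AEMeasurable (Y i) P) (hY : iIndepFun Y P) (hν : ∀ i, P.map (Y i) = ν)
    {ζ : 𝓧 → E} (hζ : StronglyMeasurable ζ) {b : ℝ} (hb : ∀ x, ‖ζ x‖ ≤ b)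
    (h0 : ∫ x, ζ x ∂ν = 0) {V : ℝ} (hV : 0 < V)
    (hvar : Fintype.card κ * ∫ x, ‖ζ x‖ ^ 2 ∂ν ≤ V) {r : ℝ} (hr : 0 ≤ r) :
    P.real {ω | r ≤ ‖∑ i, ζ (Y i ω)‖} ≤ 2 * Real.exp (-(r ^ 2 / (2 * (V + b * r / 3)))) := by
  obtain ⟨x0⟩ : Nonempty 𝓧 := ν.nonempty_of_neZero
  have hb0 : 0 ≤ b := (norm_nonneg _).trans (hb x0)
  set D := V + b * r / 3 with hD
  have hDpos : 0 < D := by positivity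
  -- The usual Bernstein choice of the exponential parameter, for which `1 - l b / 3 = V / D`.
  set l := r / D with hl
  have hl0 : 0 ≤ l := by positivity
  have hlb : 1 - l * b / 3 = V / D := by
    rw [hl, eq_div_iff hDpos.ne', sub_mul, hD]; field_simp; ring
  have hlb0 : 0 < 1 - l * b / 3 := by rw [hlb]; positivity
  have hnorm : ∀ x, ‖l • ζ x‖ = l * ‖ζ x‖ := fun x => by
    rw [norm_smul, Real.norm_eq_abs, abs_of_nonneg hl0]
  have hmgf := integral_cosh_norm_sum_le (ξ := fun x => l • ζ x) hYm hY hν (hζ.const_smul l) (B := l * b)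
    (fun x => by rw [hnorm]; gcongr; exact hb x)
    (by rw [integral_smul, h0, smul_zero]) Finset.univ
  have hc : ∫ x, (Real.exp ‖l • ζ x‖ - 1 - ‖l • ζ x‖) ∂ν ≤
      l ^ 2 * D / (2 * V) * ∫ x, ‖ζ x‖ ^ 2 ∂ν := by
    rw [← integral_const_mul]
    refine integral_mono_of_nonneg (ae_of_all _ fun x => ?_) ?_ (ae_of_all _ fun x => ?_)
    · have := Real.add_one_le_exp ‖l • ζ x‖
      simp only [Pi.zero_apply]
      linarith
    · refine Integrable.const_mul (Integrable.of_bound (hζ.norm.pow 2).aestronglyMeasurable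
        (b ^ 2) (ae_of_all _ fun x => ?_)) _
      simp only [Pi.pow_apply, norm_pow, norm_norm]
      gcongr
      exact hb x
    · simp only [hnorm]
      have h1 : l * ‖ζ x‖ ≤ l * b := by gcongr; exact hb x
      refine (exp_sub_one_sub_id_le (by positivity) (by linarith)).trans ?_
      calc (l * ‖ζ x‖) ^ 2 / (2 * (1 - l * ‖ζ x‖ / 3))
          ≤ (l * ‖ζ x‖) ^ 2 / (2 * (1 - l * b / 3)) := by gcongr
        _ = _ := by rw [hlb]; field_simp
  have hpow : (1 + ∫ x, (Real.exp ‖l • ζ x‖ - 1 - ‖l • ζ x‖) ∂ν) ^ (Fintype.card κ) ≤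
      Real.exp (r ^ 2 / (2 * D)) := by
    set c := ∫ x, (Real.exp ‖l • ζ x‖ - 1 - ‖l • ζ x‖) ∂ν
    have hc0 : 0 ≤ c := integral_nonneg fun x => by
      have := Real.add_one_le_exp ‖l • ζ x‖
      simp only [Pi.zero_apply]
      linarith
    calc (1 + c) ^ (Fintype.card κ) ≤ (Real.exp c) ^ (Fintype.card κ) := by
          gcongr; linarith [Real.add_one_le_exp c]
      _ = Real.exp (Fintype.card κ * c) := by rw [← Real.exp_nat_mul]
      _ ≤ _ := by
        gcongr
        calc Fintype.card κ * c ≤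
              Fintype.card κ * (l ^ 2 * D / (2 * V) * ∫ x, ‖ζ x‖ ^ 2 ∂ν) := by gcongr
          _ = l ^ 2 * D / (2 * V) * (Fintype.card κ * ∫ x, ‖ζ x‖ ^ 2 ∂ν) := by ring
          _ ≤ l ^ 2 * D / (2 * V) * V := by gcongr
          _ = _ := by rw [hl]; field_simp
  rw [Finset.card_univ] at hmgf
  have hint : Integrable (fun ω => Real.cosh ‖∑ i, l • ζ (Y i ω)‖) P := by
    refine Integrable.of_bound ?_ (Real.cosh (Fintype.card κ * (l * b)))
      (ae_of_all _ fun ω => ?_)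
    · refine Real.continuous_cosh.comp_aestronglyMeasurable (AEStronglyMeasurable.norm ?_)
      exact Finset.aestronglyMeasurable_fun_sum _ fun i _ =>
        ((hζ.aestronglyMeasurable).comp_aemeasurable (hYm i)).const_smul l
    · rw [Real.norm_eq_abs, abs_of_pos (Real.cosh_pos _), Real.cosh_le_cosh, abs_norm]
      refine le_trans ?_ (le_abs_self _)
      refine (norm_sum_le_of_le _ fun i _ => (hnorm _).le.trans
        (mul_le_mul_of_nonneg_left (hb (Y i ω)) hl0)).trans ?_
      simp
  -- Markov's inequality for `cosh`, using `cosh u ≥ exp u / 2`; this is the origin of the factor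
  -- `2` in the bound.
  have hmarkov := mul_meas_ge_le_integral_of_nonneg (ae_of_all P fun ω =>
    (Real.cosh_pos ‖∑ i, l • ζ (Y i ω)‖).le) hint (Real.exp (l * r) / 2)
  have hsub : P.real {ω | r ≤ ‖∑ i, ζ (Y i ω)‖} ≤
      P.real {ω | Real.exp (l * r) / 2 ≤ Real.cosh ‖∑ i, l • ζ (Y i ω)‖} := by
    refine measureReal_mono fun ω hω => ?_
    rw [mem_ofPred_eq] at hω ⊢
    rw [← Finset.smul_sum, norm_smul, Real.norm_eq_abs, abs_of_nonneg hl0, Real.cosh_eq]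
    have h1 : Real.exp (l * r) ≤ Real.exp (l * ‖∑ i, ζ (Y i ω)‖) := by gcongr
    have h2 := Real.exp_pos (-(l * ‖∑ i, ζ (Y i ω)‖))
    linarith
  have hfin : Real.exp (l * r) / 2 * P.real {ω | r ≤ ‖∑ i, ζ (Y i ω)‖} ≤
      Real.exp (r ^ 2 / (2 * D)) :=
    (mul_le_mul_of_nonneg_left hsub (by positivity)).trans (hmarkov.trans (hmgf.trans hpow))
  have hexp : Real.exp (-(r ^ 2 / (2 * D))) =
      Real.exp (r ^ 2 / (2 * D)) / Real.exp (l * r) := by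
    rw [← Real.exp_sub]
    congr 1
    rw [hl]; field_simp; ring
  rw [hexp, mul_div_assoc', le_div_iff₀ (Real.exp_pos _)]
  linarith

end Bernstein

/-! ### Order statistics against exceedances of a threshold. -/

section Counting

variable {H : Type*} [NormedAddCommGroup H]

/-- Replacing the `k` largest observations by those above a threshold changes the sum of any
function bounded by one by at most the difference of the numbers of terms. -/
lemma norm_sum_top_sub_sum_exceed_le {E : Type*} [NormedAddCommGroup E] [NormedSpace ℝ E]
    {F : H → E} (hF : ∀ x, ‖F x‖ ≤ 1) {n k : ℕ} (hk : k ≤ n) {x : Fin n → H}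
    {σ : Equiv.Perm (Fin n)} (hσ : IsNormSorted x σ) (t : ℝ) :
    ‖(∑ i : Fin n, if i.val < k then F (x (σ i)) else 0) -
        ∑ i, {y : H | t < ‖y‖}.indicator F (x i)‖ ≤
      |(∑ i, {y : H | t < ‖y‖}.indicator (fun _ => (1 : ℝ)) (x i)) - k| := by
  classical
  set d : Fin n → ℝ := fun i =>
    {y : H | t < ‖y‖}.indicator (fun _ => (1 : ℝ)) (x (σ i)) - if i.val < k then 1 else 0 with hd
  have hsum : ∑ i, d i = (∑ i, {y : H | t < ‖y‖}.indicator (fun _ => (1 : ℝ)) (x i)) - k := by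
    rw [hd, Finset.sum_sub_distrib,
      Equiv.sum_comp σ fun i => {y : H | t < ‖y‖}.indicator (fun _ => (1 : ℝ)) (x i)]
    congr 1
    rw [Finset.sum_boole, Fin.card_filter_val_lt, min_eq_right hk]
  -- In sorted order both index sets are initial segments, hence nested. So `d` has constant sign
  -- and its absolute sum is the difference of the cardinalities.
  have habs : ∑ i, |d i| = |∑ i, d i| := by
    by_cases hpos : ∀ i, 0 ≤ d i
    · rw [abs_of_nonneg (Finset.sum_nonneg fun i _ => hpos i)]
      exact Finset.sum_congr rfl fun i _ => abs_of_nonneg (hpos i)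
    · have hneg : ∀ i, d i ≤ 0 := by
        push Not at hpos
        obtain ⟨i, hi⟩ := hpos
        intro j
        by_contra! hj
        have hik : i.val < k ∧ ¬ t < ‖x (σ i)‖ := by
          simp only [hd, indicator_apply, mem_ofPred_eq] at hi
          split_ifs at hi <;> norm_num at hi
          exact ⟨by assumption, by assumption⟩
        have hjk : ¬ j.val < k ∧ t < ‖x (σ j)‖ := by
          simp only [hd, indicator_apply, mem_ofPred_eq] at hj
          split_ifs at hj <;> norm_num at hj
          exact ⟨by assumption, by assumption⟩
        have hij : i ≤ j := Fin.le_def.2 (by omega)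
        exact hik.2 (hjk.2.trans_le (hσ hij))
      rw [abs_of_nonpos (Finset.sum_nonpos fun i _ => hneg i), ← Finset.sum_neg_distrib]
      exact Finset.sum_congr rfl fun i _ => abs_of_nonpos (hneg i)
  rw [← hsum, ← habs, ← Equiv.sum_comp σ fun i => {y : H | t < ‖y‖}.indicator F (x i),
    ← Finset.sum_sub_distrib]
  refine norm_sum_le_of_le _ fun i _ => ?_
  have h1 := hF (x (σ i))
  simp only [hd, indicator_apply]
  split_ifs <;> simp <;> linarith

end Counting

/-! ### The angle and its tensor square: bounds, measurability, integrals. -/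

section Angle

variable {H : Type*} [NormedAddCommGroup H] [InnerProductSpace ℝ H]

lemma norm_angle_le (x : H) : ‖angle x‖ ≤ 1 := by
  rw [angle, norm_smul, norm_inv, norm_norm]
  exact inv_mul_le_one

variable {ι : Type*}

/-- The operator `θ(x) ⊗ θ(x)`, seen in `ℓ²(ι, H)`. -/
def angleTens (b : HilbertBasis ι ℝ H) (x : H) : lp (fun _ : ι => H) 2 :=
  tens b (angle x) (angle x)

lemma norm_angleTens_le (b : HilbertBasis ι ℝ H) (x : H) : ‖angleTens b x‖ ≤ 1 := by
  rw [angleTens, norm_tens_self]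
  exact pow_le_one₀ (norm_nonneg _) (norm_angle_le x)

lemma continuous_tens_self (b : HilbertBasis ι ℝ H) : Continuous fun x => tens b x x := by
  fun_prop

lemma isCov_empCov {n : ℕ} (x : Fin n → H) (σ : Equiv.Perm (Fin n)) (k : ℕ) :
    IsCov (empCov x σ k) := by
  refine IsCov.smul (IsCov.sum _ fun i _ => ?_) (by positivity)
  split_ifs
  · exact isCov_tensorSq _
  · exact isCov_zero

/-- The empirical operator `Ĉ_k`, seen in `ℓ²(ι, H)`. -/
def empTens (b : HilbertBasis ι ℝ H) {n : ℕ} (x : Fin n → H) (σ : Equiv.Perm (Fin n)) (k : ℕ) :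
    lp (fun _ : ι => H) 2 :=
  (k : ℝ)⁻¹ • ∑ i : Fin n, if i.val < k then angleTens b (x (σ i)) else 0

lemma represents_empTens (b : HilbertBasis ι ℝ H) {n : ℕ} (x : Fin n → H)
    (σ : Equiv.Perm (Fin n)) (k : ℕ) : Represents b (empTens b x σ k) (empCov x σ k) := by
  refine Represents.smul _ (Represents.sum _ fun i _ => ?_)
  split_ifs
  · exact represents_tens b _
  · exact fun _ => by simp

variable [TopologicalSpace.SeparableSpace H] [MeasurableSpace H] [BorelSpace H]

lemma measurable_angle : Measurable (angle : H → H) := by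
  have : SecondCountableTopology H := UniformSpace.secondCountable_of_separable H
  exact (measurable_norm.inv).smul measurable_id

lemma stronglyMeasurable_tens_self (b : HilbertBasis ι ℝ H) :
    StronglyMeasurable fun x => tens b x x := by
  have : SecondCountableTopology H := UniformSpace.secondCountable_of_separable H
  exact (continuous_tens_self b).stronglyMeasurable

lemma stronglyMeasurable_angleTens (b : HilbertBasis ι ℝ H) :
    StronglyMeasurable (angleTens b) :=
  (stronglyMeasurable_tens_self b).comp_measurable measurable_angle

lemma represents_integral [CompleteSpace H] (b : HilbertBasis ι ℝ H) {Ω : Type*}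
    [MeasurableSpace Ω] {Q : Measure Ω} [IsFiniteMeasure Q] {f : Ω → H} (hf : Measurable f)
    (hb : ∀ᵐ ω ∂Q, ‖f ω‖ ≤ 1) :
    Represents b (∫ ω, tens b (f ω) (f ω) ∂Q) (∫ ω, tensorSq (f ω) ∂Q) := by
  have hsc : SecondCountableTopology H := UniformSpace.secondCountable_of_separable H
  intro i
  have h1 : Integrable (fun ω => tens b (f ω) (f ω)) Q := by
    refine Integrable.of_bound ((stronglyMeasurable_tens_self b).comp_measurable
      hf).aestronglyMeasurable 1 ?_
    filter_upwards [hb] with ω hω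
    rw [norm_tens_self]
    exact pow_le_one₀ (norm_nonneg _) hω
  have h2 : Integrable (fun ω => tensorSq (f ω)) Q := by
    have hc : Continuous (tensorSq : H → H →L[ℝ] H) := by exact (InnerProductSpace.rankOne ℝ).continuous.clm_apply continuous_id
    refine Integrable.of_bound (hc.stronglyMeasurable.comp_measurable hf).aestronglyMeasurable 1 ?_
    filter_upwards [hb] with ω hω
    rw [tensorSq, InnerProductSpace.norm_rankOne]
    exact mul_le_one₀ hω (norm_nonneg _) hω
  rw [ContinuousLinearMap.integral_apply h2]
  have h3 := (lp.evalCLM ℝ (fun _ : ι => H) 2 i).integral_comp_comm h1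
  exact h3.symm.trans (integral_congr_ae (ae_of_all _ fun ω => represents_tens b (f ω) i))

end Angle

/-! ### Concentration of sums over exceedances. -/

section Deviation

lemma integral_norm_sub_integral_sq_le {𝓧 : Type*} [MeasurableSpace 𝓧] {E : Type*} [NormedAddCommGroup E]
    [InnerProductSpace ℝ E] [CompleteSpace E] {Q : Measure 𝓧} [IsProbabilityMeasure Q] 
    {ξ : 𝓧 → E} (hξ : StronglyMeasurable ξ) (hb : ∀ x, ‖ξ x‖ ≤ 1) :
    ∫ x, ‖ξ x - ∫ y, ξ y ∂Q‖ ^ 2 ∂Q ≤ ∫ x, ‖ξ x‖ ^ 2 ∂Q := by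
  set m := ∫ y, ξ y ∂Q with hm
  have hi : Integrable ξ Q := Integrable.of_bound hξ.aestronglyMeasurable 1 (ae_of_all _ hb)
  have hi2 : Integrable (fun x => ‖ξ x‖ ^ 2) Q := by
    refine Integrable.of_bound (hξ.norm.pow 2).aestronglyMeasurable 1 (ae_of_all _ fun x => ?_)
    simp only [norm_pow, norm_norm]
    exact pow_le_one₀ (norm_nonneg _) (hb x)
  have hi3 : Integrable (fun x => 2 * inner ℝ m (ξ x)) Q := (hi.const_inner m).const_mul 2
  have h1 : ∀ x, ‖ξ x - m‖ ^ 2 = ‖ξ x‖ ^ 2 - 2 * inner ℝ m (ξ x) + ‖m‖ ^ 2 := fun x => by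
    rw [norm_sub_sq_real, real_inner_comm]
  simp only [h1]
  rw [integral_add (by exact hi2.sub hi3) (integrable_const _), integral_sub hi2 hi3,
    integral_const_mul, integral_inner hi, ← hm, real_inner_self_eq_norm_sq]
  simp only [integral_const, probReal_univ, one_smul]
  nlinarith [sq_nonneg ‖m‖]

variable {H : Type*} [NormedAddCommGroup H] [MeasurableSpace H] [BorelSpace H]
  {Ω : Type*} [MeasurableSpace Ω] {P : Measure Ω} [IsProbabilityMeasure P]
  {E : Type*} [NormedAddCommGroup E] [InnerProductSpace ℝ E] [CompleteSpace E]

/-- Deviation of the sum over the exceedances of the threshold `t`. -/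
lemma exceedance_deviation {X : Ω → H} (hX : AEMeasurable X P) {n : ℕ} {S : Fin n → Ω → H}
    (hS : iIndepFun S P) (hlaw : ∀ i, IdentDistrib (S i) X P P) (t : ℝ) {ξ : H → E}
    (hξ : StronglyMeasurable ξ)
    (hb : ∀ x, ‖ξ x‖ ≤ {y : H | t < ‖y‖}.indicator (fun _ => (1 : ℝ)) x) {V : ℝ} (hV : 0 < V)
    (hnV : n * P.real {ω | t < ‖X ω‖} ≤ V) {r : ℝ} (hr : 0 ≤ r) :
    P.real {ω | r ≤ ‖(∑ i, ξ (S i ω)) - (n : ℝ) • ∫ ω, ξ (X ω) ∂P‖} ≤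
      2 * Real.exp (-(r ^ 2 / (2 * (V + 2 * r / 3)))) := by
  set Q := P.map X with hQ
  have : IsProbabilityMeasure Q := Measure.isProbabilityMeasure_map hX
  have hle : ∀ x, {y : H | t < ‖y‖}.indicator (fun _ => (1 : ℝ)) x ≤ 1 := fun x =>
    indicator_le_self' (fun _ _ => zero_le_one) x
  have hb1 : ∀ x, ‖ξ x‖ ≤ 1 := fun x => (hb x).trans (hle x)
  have hmeas : MeasurableSet {y : H | t < ‖y‖} := measurableSet_lt measurable_const measurable_norm
  have hi : Integrable ξ Q := Integrable.of_bound hξ.aestronglyMeasurable 1 (ae_of_all _ hb1)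
  have hm : ∫ ω, ξ (X ω) ∂P = ∫ x, ξ x ∂Q := (integral_map hX hξ.aestronglyMeasurable).symm
  have hm1 : ‖∫ x, ξ x ∂Q‖ ≤ 1 := by
    simpa using norm_integral_le_of_norm_le_const (μ := Q) (ae_of_all _ hb1)
  rw [hm]
  -- The centred summand is bounded by `1 + 1`, whence `b = 2`.
  have h := bernstein_hilbert (P := P) (ν := Q) (ζ := fun x => ξ x - ∫ y, ξ y ∂Q) (b := 2)
    (fun i => (hlaw i).aemeasurable_fst) hS (fun i => (hlaw i).map_eq)
    (hξ.sub stronglyMeasurable_const)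
    (fun x => (norm_sub_le _ _).trans (by linarith [hb1 x]))
    (by rw [integral_sub hi (integrable_const _)]; simp) hV ?_ hr
  · simpa [Finset.sum_sub_distrib, ← Nat.cast_smul_eq_nsmul ℝ] using h
  · refine le_trans ?_ hnV
    rw [Fintype.card_fin]
    gcongr
    refine (integral_norm_sub_integral_sq_le hξ hb1).trans ?_
    have hpre : P.real {ω | t < ‖X ω‖} = ∫ x, {y : H | t < ‖y‖}.indicator (fun _ => (1 : ℝ)) x ∂Q := by
      rw [integral_indicator_const _ hmeas, smul_eq_mul, mul_one, hQ,
        map_measureReal_apply_of_aemeasurable hX hmeas]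
      rfl
    rw [hpre]
    refine integral_mono_of_nonneg (ae_of_all _ fun x => sq_nonneg _)
      ((integrable_const (1 : ℝ)).indicator hmeas) (ae_of_all _ fun x => ?_)
    -- Since `‖ξ‖² ≤ ‖ξ‖ ≤ 1{‖x‖ > t}`, the variance is at most the exceedance probability, not
    -- merely `1`.
    calc ‖ξ x‖ ^ 2 = ‖ξ x‖ * ‖ξ x‖ := sq _
      _ ≤ ‖ξ x‖ * 1 := by gcongr; exact hb1 x
      _ ≤ _ := by rw [mul_one]; exact hb x

end Deviation

/-! ### The finite sample bound. -/

section FiniteSample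

lemma measurableSet_lt_norm {H : Type*} [NormedAddCommGroup H] [MeasurableSpace H]
    [BorelSpace H] (t : ℝ) : MeasurableSet {y : H | t < ‖y‖} :=
  measurableSet_lt measurable_const measurable_norm

lemma integral_indicator_one_comp {H : Type*} [MeasurableSpace H] {Ω : Type*} [MeasurableSpace Ω]
    {P : Measure Ω} {X : Ω → H} (hX : Measurable X) {U : Set H} (hU : MeasurableSet U) :
    ∫ ω, U.indicator (fun _ => (1 : ℝ)) (X ω) ∂P = P.real (X ⁻¹' U) := by
  have := integral_indicator_const (μ := P) (1 : ℝ) (hX hU)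
  rw [smul_eq_mul, mul_one] at this
  exact this

/-- Three errors: fluctuation of the exceedance sum, fluctuation of the exceedance count, and the
bias between the expected count `n q` and `k`. The last two control `|N - k|`, the price of
replacing order statistics by exceedances. -/
lemma norm_empTens_sub_le {H : Type*} [NormedAddCommGroup H] [InnerProductSpace ℝ H] {ι : Type*}
    (b : HilbertBasis ι ℝ H) {n k : ℕ} (hk : 1 ≤ k) (hkn : k ≤ n)
    {x : Fin n → H} {σ : Equiv.Perm (Fin n)} (hσ : IsNormSorted x σ) (t q : ℝ)
    (m : lp (fun _ : ι => H) 2) :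
    ‖empTens b x σ k - ((n : ℝ) / k) • m‖ ≤
      (‖(∑ i, {y : H | t < ‖y‖}.indicator (angleTens b) (x i)) - (n : ℝ) • m‖ +
        ‖(∑ i, {y : H | t < ‖y‖}.indicator (fun _ => (1 : ℝ)) (x i)) - (n : ℝ) • q‖ +
        |n * q - k|) / k := by
  have hk0 : (0 : ℝ) < k := by exact_mod_cast hk
  have h1 := norm_sum_top_sub_sum_exceed_le (norm_angleTens_le b) hkn hσ t
  set T := ∑ i : Fin n, if i.val < k then angleTens b (x (σ i)) else 0 with hT
  set U := ∑ i, {y : H | t < ‖y‖}.indicator (angleTens b) (x i) with hU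
  set N := ∑ i, {y : H | t < ‖y‖}.indicator (fun _ => (1 : ℝ)) (x i) with hN
  have h2 : empTens b x σ k - ((n : ℝ) / k) • m = (k : ℝ)⁻¹ • ((T - U) + (U - (n : ℝ) • m)) := by
    rw [empTens, ← hT, sub_add_sub_cancel, smul_sub, smul_smul, div_eq_inv_mul]
  rw [h2, norm_smul, norm_inv, Real.norm_of_nonneg hk0.le, ← div_eq_inv_mul]
  gcongr
  have h3 : |N - k| ≤ ‖N - (n : ℝ) • q‖ + |n * q - k| := by
    rw [Real.norm_eq_abs, smul_eq_mul]
    exact abs_sub_le _ _ _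
  linarith [norm_add_le (T - U) (U - (n : ℝ) • m)]

lemma isCov_condCov {H : Type*} [NormedAddCommGroup H] [InnerProductSpace ℝ H] [CompleteSpace H]
    {Ω : Type*} [MeasurableSpace Ω] {P : Measure Ω} [IsProbabilityMeasure P] {X : Ω → H} {t : ℝ} (ht : 0 < P.real {ω | t < ‖X ω‖}) :
    IsCov (condCov P X t) := by
  have : IsProbabilityMeasure (P[|{ω | t < ‖X ω‖}]) :=
    cond_isProbabilityMeasure fun h => by simp [measureReal_def, h] at ht
  exact isCov_integral fun ω => isCov_tensorSq _

variable {H : Type*} [NormedAddCommGroup H] [InnerProductSpace ℝ H] [CompleteSpace H]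
  [TopologicalSpace.SeparableSpace H] [MeasurableSpace H] [BorelSpace H]
  {Ω : Type*} [MeasurableSpace Ω] {P : Measure Ω} {ι : Type*}

/-- `E[Θ ⊗ Θ 1{‖X‖ > t}]`, seen in `ℓ²(ι, H)`. -/
def exceedMean (b : HilbertBasis ι ℝ H) (P : Measure Ω) (X : Ω → H) (t : ℝ) :
    lp (fun _ : ι => H) 2 :=
  ∫ ω, {y : H | t < ‖y‖}.indicator (angleTens b) (X ω) ∂P

lemma represents_condCov (b : HilbertBasis ι ℝ H) {X : Ω → H} (hX : Measurable X) (t : ℝ) :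
    Represents b ((P.real {ω | t < ‖X ω‖})⁻¹ • exceedMean b P X t) (condCov P X t) := by
  have hms : MeasurableSet {ω | t < ‖X ω‖} := hX (measurableSet_lt_norm t)
  have h := represents_integral b (Q := P[|{ω | t < ‖X ω‖}]) (measurable_angle.comp hX)
    (ae_of_all _ fun ω => norm_angle_le (X ω))
  have hm : ∫ ω, tens b ((angle ∘ X) ω) ((angle ∘ X) ω) ∂(P[|{ω | t < ‖X ω‖}]) =
      (P.real {ω | t < ‖X ω‖})⁻¹ • exceedMean b P X t := by
    rw [ProbabilityTheory.cond, integral_smul_measure, ENNReal.toReal_inv, exceedMean,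
      ← integral_indicator hms]
    rfl
  rwa [hm] at h

variable [IsProbabilityMeasure P]

/-- Bernstein is used twice, with values in `ℓ²(ι, H)` and in `ℝ`, hence the factor `4`. The event
depends neither on `k` nor on `σ`, so every way of breaking ties is covered at once. -/
lemma exists_event_norm_empTens_sub_le (b : HilbertBasis ι ℝ H) {X : Ω → H} (hX : Measurable X)
    {n : ℕ} {S : Fin n → Ω → H} (hS : iIndepFun S P) (hlaw : ∀ i, IdentDistrib (S i) X P P)
    (t : ℝ) {V : ℝ} (hV : 0 < V) (hnV : n * P.real {ω | t < ‖X ω‖} ≤ V) {r : ℝ} (hr : 0 ≤ r) :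
    ∃ A : Set Ω, MeasurableSet A ∧ P.real Aᶜ ≤ 4 * Real.exp (-(r ^ 2 / (2 * (V + 2 * r / 3)))) ∧
      ∀ ω ∈ A, ∀ k : ℕ, 1 ≤ k → k ≤ n → ∀ σ : Equiv.Perm (Fin n),
        IsNormSorted (fun i => S i ω) σ →
        ‖empTens b (fun i => S i ω) σ k - ((n : ℝ) / k) • exceedMean b P X t‖ ≤
          (2 * r + |n * P.real {ω | t < ‖X ω‖} - k|) / k := by
  have hms := measurableSet_lt_norm (H := H) t
  have hq : ∫ ω, {y : H | t < ‖y‖}.indicator (fun _ => (1 : ℝ)) (X ω) ∂P =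
      P.real {ω | t < ‖X ω‖} := integral_indicator_one_comp hX hms
  have h1 := exceedance_deviation hX.aemeasurable hS hlaw t
    ((stronglyMeasurable_angleTens b).indicator hms)
    (fun x => by
      rw [norm_indicator_eq_indicator_norm]
      exact indicator_le_indicator (norm_angleTens_le b x)) hV hnV hr
  have h2 := exceedance_deviation (E := ℝ) hX.aemeasurable hS hlaw t
    ((stronglyMeasurable_const (b := (1 : ℝ))).indicator hms)
    (fun x => by
      rw [norm_indicator_eq_indicator_norm]
      simp) hV hnV hr
  rw [hq] at h2
  set D₁ := {ω | r ≤ ‖(∑ i, {y : H | t < ‖y‖}.indicator (angleTens b) (S i ω)) -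
    (n : ℝ) • ∫ ω, {y : H | t < ‖y‖}.indicator (angleTens b) (X ω) ∂P‖}
  set D₂ := {ω | r ≤ ‖(∑ i, {y : H | t < ‖y‖}.indicator (fun _ => (1 : ℝ)) (S i ω)) -
    (n : ℝ) • P.real {ω | t < ‖X ω‖}‖}
  -- A measurable cover of the bad set has the same probability.
  refine ⟨(toMeasurable P (D₁ ∪ D₂))ᶜ, (measurableSet_toMeasurable _ _).compl, ?_, ?_⟩
  · rw [compl_compl, measureReal_def, measure_toMeasurable, ← measureReal_def]
    linarith [measureReal_union_le (μ := P) D₁ D₂]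
  · intro ω hω k hk hkn σ hσ
    have hω' : ω ∉ D₁ ∪ D₂ := fun h => hω (subset_toMeasurable P _ h)
    have hω1 : ¬ r ≤ _ := fun h => hω' (Or.inl h)
    have hω2 : ¬ r ≤ _ := fun h => hω' (Or.inr h)
    refine (norm_empTens_sub_le b hk hkn hσ t (P.real {ω | t < ‖X ω‖}) _).trans ?_
    rw [exceedMean]
    gcongr
    linarith [not_le.1 hω1, not_le.1 hω2]

/-- With `s = √(2 V L)`, the difference `r² - 2 L (V + 2 r / 3)` equals `4 s L / 3`. -/
lemma bernstein_exponent_ge {L V r : ℝ} (hL : 0 ≤ L) (hV : 0 < V)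
    (hr : r = √(2 * V * L) + 4 * L / 3) : L ≤ r ^ 2 / (2 * (V + 2 * r / 3)) := by
  have hs := Real.sqrt_nonneg (2 * V * L)
  have hsq := Real.sq_sqrt (by positivity : 0 ≤ 2 * V * L)
  have hr0 : 0 ≤ r := by rw [hr]; positivity
  rw [le_div_iff₀ (by positivity)]
  set s := √(2 * V * L)
  rw [hr]
  nlinarith [mul_nonneg hs hL]

/-- The square-root term is exactly `√(8 log(4/δ)) / √k`. The linear term fits because `4/δ ≤
(2/δ)²` gives `log(4/δ) ≤ 2 log(2/δ)`. The summand `1 + 4 √(log(2/δ))` of the bound is slack. -/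
lemma two_mul_div_le_statBound {k : ℕ} (hk : 1 ≤ k) {δ : ℝ} (hδ : 0 < δ) (hδ1 : δ < 1) :
    2 * (√(2 * k * Real.log (4 / δ)) + 4 * Real.log (4 / δ) / 3) / k ≤ statBound k δ := by
  have hk0 : (0 : ℝ) < k := by exact_mod_cast hk
  have hsk : 0 < √(k : ℝ) := Real.sqrt_pos.2 hk0
  have hL0 : 0 < Real.log (4 / δ) := Real.log_pos (by rw [lt_div_iff₀ hδ]; linarith)
  have hLL : Real.log (4 / δ) ≤ 2 * Real.log (2 / δ) := by
    rw [← Nat.cast_ofNat (R := ℝ) (n := 2), ← Real.log_pow]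
    refine Real.log_le_log (by positivity) ?_
    rw [Nat.cast_ofNat, div_pow, div_le_div_iff₀ hδ (by positivity)]
    nlinarith
  have h1 : 2 * √(2 * k * Real.log (4 / δ)) / k = √(8 * Real.log (4 / δ)) / √k := by
    have h8 : √(8 * Real.log (4 / δ)) = 2 * √(2 * Real.log (4 / δ)) := by
      rw [show 8 * Real.log (4 / δ) = 2 ^ 2 * (2 * Real.log (4 / δ)) by ring,
        Real.sqrt_mul (by positivity : (0 : ℝ) ≤ 2 ^ 2), Real.sqrt_sq (by norm_num)]
    rw [div_eq_div_iff hk0.ne' hsk.ne', mul_comm (2 : ℝ) (k : ℝ), mul_assoc (k : ℝ),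
      Real.sqrt_mul hk0.le, h8]
    have := Real.mul_self_sqrt hk0.le
    linear_combination (2 * √(2 * Real.log (4 / δ))) * this
  rw [statBound, mul_add, add_div, h1]
  refine add_le_add ?_ ?_
  · gcongr
    linarith [Real.sqrt_nonneg (Real.log (2 / δ))]
  · rw [div_le_div_iff₀ hk0 (by positivity)]
    nlinarith

theorem finite_sample_bound {X : Ω → H} (hX : Measurable X)
    {n : ℕ} {S : Fin n → Ω → H} (hS : iIndepFun S P) (hlaw : ∀ i, IdentDistrib (S i) X P P)
    {p k : ℕ} (hp : 1 ≤ p) (hk : 1 ≤ k) (hkn : k ≤ n) {t : ℝ}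
    (ht : P.real {ω | t < ‖X ω‖} = (k : ℝ) / n) (hgap : 0 < eigengap (condCov P X t) p)
    {δ : ℝ} (hδ : 0 < δ) (hδ1 : δ < 1) :
    ∃ A : Set Ω, MeasurableSet A ∧ 1 - δ ≤ P.real A ∧ ∀ ω ∈ A,
      ∀ σ : Equiv.Perm (Fin n), IsNormSorted (fun i => S i ω) σ →
      ∀ (W V : Submodule ℝ H) [FiniteDimensional ℝ W] [FiniteDimensional ℝ V],
        IsLeadingEigenspace (empCov (fun i => S i ω) σ k) p W →
        IsLeadingEigenspace (condCov P X t) p V →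
        rho W V ≤ ENNReal.ofReal (statBound k δ / eigengap (condCov P X t) p) := by
  obtain ⟨b, hb⟩ := (exists_hilbertBasis ℝ H).choose_spec
  have hk0 : (0 : ℝ) < k := by exact_mod_cast hk
  have hn0 : (0 : ℝ) < n := by exact_mod_cast hk.trans hkn
  have hnq : n * P.real {ω | t < ‖X ω‖} = k := by rw [ht]; field_simp
  have hL0 : 0 ≤ Real.log (4 / δ) := Real.log_nonneg (by rw [le_div_iff₀ hδ]; linarith)
  set r := √(2 * k * Real.log (4 / δ)) + 4 * Real.log (4 / δ) / 3 with hr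
  have hr0 : 0 ≤ r := by positivity
  obtain ⟨A, hA, hPA, hAω⟩ := exists_event_norm_empTens_sub_le b hX hS hlaw t hk0 hnq.le hr0
  refine ⟨A, hA, ?_, ?_⟩
  · have h1 : 4 * Real.exp (-(r ^ 2 / (2 * (k + 2 * r / 3)))) ≤ δ := by
      calc _ ≤ 4 * Real.exp (-Real.log (4 / δ)) := by
            gcongr; exact bernstein_exponent_ge hL0 hk0 hr
        _ = δ := by rw [Real.exp_neg, Real.exp_log (by positivity)]; field_simp
    rw [probReal_compl_eq_one_sub hA] at hPA
    linarith
  · intro ω hω σ hσ W V _ _ hW hV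
    have hq0 : 0 < P.real {ω | t < ‖X ω‖} := by rw [ht]; positivity
    refine (rho_le_of_represents hb (isCov_condCov hq0) (isCov_empCov _ σ k)
      (represents_condCov b hX t) (represents_empTens b _ σ k) hp hgap hW hV).trans ?_
    gcongr
    have h2 := hAω ω hω k hk hkn σ hσ
    rw [hnq, sub_self, abs_zero, add_zero] at h2
    -- As `P(R > t) = k / n`, the centring `(n / k) • exceedMean` is exactly `C_t` and there is no
    -- bias.
    rw [ht, inv_div]
    exact h2.trans (two_mul_div_le_statBound hk hδ hδ1)

end FiniteSample

/-! ### Polar structure of the limit measure and continuous cutoffs. -/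

section LimitMeasure

variable {H : Type*} [NormedAddCommGroup H] [InnerProductSpace ℝ H]

lemma angle_smul {c : ℝ} (hc : 0 < c) (x : H) : angle (c • x) = angle x := by
  rw [angle, angle, norm_smul, Real.norm_of_nonneg hc.le, smul_smul, mul_inv, mul_comm c⁻¹,
    mul_assoc, inv_mul_cancel₀ hc.ne', mul_one]

lemma continuousAt_angle {x : H} (hx : x ≠ 0) : ContinuousAt angle x :=
  (continuousAt_id.norm.inv₀ (norm_ne_zero_iff.2 hx)).smul continuousAt_id

/-- The continuous function equal to `0` below `lo`, to `1` above `hi`, and affine in between. -/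
def cutoff (lo hi r : ℝ) : ℝ := max 0 (min 1 ((r - lo) / (hi - lo)))

lemma continuous_cutoff (lo hi : ℝ) : Continuous (cutoff lo hi) := by
  unfold cutoff; fun_prop

lemma cutoff_nonneg (lo hi r : ℝ) : 0 ≤ cutoff lo hi r := le_max_left _ _

lemma cutoff_le_one (lo hi r : ℝ) : cutoff lo hi r ≤ 1 := max_le zero_le_one (min_le_left _ _)

lemma cutoff_eq_zero {lo hi r : ℝ} (h : lo < hi) (hr : r ≤ lo) : cutoff lo hi r = 0 :=
  max_eq_left ((min_le_right _ _).trans (div_nonpos_of_nonpos_of_nonneg (by linarith)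
    (by linarith)))

lemma cutoff_eq_one {lo hi r : ℝ} (h : lo < hi) (hr : hi ≤ r) : cutoff lo hi r = 1 := by
  rw [cutoff, min_eq_left, max_eq_right zero_le_one]
  rw [le_div_iff₀ (by linarith)]
  linarith

/-- The bounded continuous function `cutoff(‖x‖) g(θ(x))`. -/
def cutoffAngle {lo hi : ℝ} (hlo : 0 < lo) (hlh : lo < hi) {g : H → ℝ} (hg : Continuous g)
    {M : ℝ} (hM : ∀ x, ‖x‖ ≤ 1 → |g x| ≤ M) : H →ᵇ ℝ :=
  BoundedContinuousFunction.ofNormedAddCommGroup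
    (fun x => cutoff lo hi ‖x‖ * g (angle x))
    (by
      rw [continuous_iff_continuousAt]
      intro x
      rcases eq_or_ne x 0 with rfl | hx
      · refine (continuousAt_const (y := (0 : ℝ))).congr ?_
        filter_upwards [Metric.ball_mem_nhds (0 : H) hlo] with y hy
        rw [cutoff_eq_zero hlh (by simpa using (mem_ball_zero_iff.1 hy).le), zero_mul]
      · exact ((continuous_cutoff lo hi).continuousAt.comp continuousAt_id.norm).mul
          (hg.continuousAt.comp (continuousAt_angle hx)))
    M (fun x => by
      rw [norm_mul, Real.norm_of_nonneg (cutoff_nonneg _ _ _), Real.norm_eq_abs]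
      have h1 := hM _ (norm_angle_le x)
      exact (mul_le_of_le_one_left (abs_nonneg _) (cutoff_le_one _ _ _)).trans h1)

lemma cutoffAngle_apply {lo hi : ℝ} (hlo : 0 < lo) (hlh : lo < hi) {g : H → ℝ}
    (hg : Continuous g) {M : ℝ} (hM : ∀ x, ‖x‖ ≤ 1 → |g x| ≤ M) (x : H) :
    cutoffAngle hlo hlh hg hM x = cutoff lo hi ‖x‖ * g (angle x) := rfl

variable [MeasurableSpace H]

/-- The (unnormalised) angular measure `μ {‖x‖ > 1, θ(x) ∈ ·}`. -/
def spectralMeasure (μ : Measure H) : Measure H := (μ.restrict {x | 1 < ‖x‖}).map angle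

variable {Ω : Type*} [MeasurableSpace Ω] {P : Measure Ω} {X : Ω → H} {α : ℝ} {μ : Measure H}

lemma IsRegularlyVarying.measure_lt_norm_lt_top (h : IsRegularlyVarying P X α μ) {c : ℝ}
    (hc : 0 < c) : μ {x | c < ‖x‖} < ∞ :=
  (measure_mono fun x (hx : c < ‖x‖) => mem_ofPred_eq ▸ hx.le).trans_lt (h.isM0.finite_away c hc)

lemma IsRegularlyVarying.isFiniteMeasure (h : IsRegularlyVarying P X α μ) :
    IsFiniteMeasure (spectralMeasure μ) := by
  have : IsFiniteMeasure (μ.restrict {x | 1 < ‖x‖}) :=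
    ⟨by rw [Measure.restrict_apply_univ]; exact h.measure_lt_norm_lt_top one_pos⟩
  exact Measure.isFiniteMeasure_map _ _

variable [TopologicalSpace.SeparableSpace H] [BorelSpace H]

/-- The angle is scale invariant, so `{‖x‖ > c, θ(x) ∈ B}` is `c` times `{‖x‖ > 1, θ(x) ∈ B}`, and
homogeneity applies. -/
lemma IsRegularlyVarying.map_angle_restrict (h : IsRegularlyVarying P X α μ) {c : ℝ}
    (hc : 0 < c) : (μ.restrict {x | c < ‖x‖}).map angle =
      ENNReal.ofReal (c ^ (-α)) • spectralMeasure μ := by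
  ext B hB
  have hB' := measurable_angle hB
  rw [Measure.smul_apply, spectralMeasure, Measure.map_apply measurable_angle hB,
    Measure.map_apply measurable_angle hB, Measure.restrict_apply hB',
    Measure.restrict_apply hB', smul_eq_mul,
    ← h.homogeneous c hc _ (hB'.inter (measurableSet_lt_norm 1))]
  congr 1
  ext x
  rw [mem_smul_set_iff_inv_smul_mem₀ hc.ne']
  simp only [mem_inter_iff, mem_preimage, mem_ofPred_eq, angle_smul (inv_pos.2 hc), norm_smul,
    Real.norm_of_nonneg (inv_pos.2 hc).le]
  rw [lt_inv_mul_iff₀ hc, mul_one]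

/-- If it vanished, homogeneity would make every `{‖x‖ > 1/(n+1)}` null. These sets exhaust `H ∖
{0}`, so `μ` would be zero. -/
lemma IsRegularlyVarying.spectralMeasure_univ_ne_zero (h : IsRegularlyVarying P X α μ) :
    spectralMeasure μ univ ≠ 0 := by
  intro h0
  refine h.ne_zero (Measure.measure_univ_eq_zero.1 (le_antisymm ?_ zero_le))
  have hcov : (univ : Set H) ⊆ {0} ∪ ⋃ n : ℕ, {x | ((n : ℝ) + 1)⁻¹ < ‖x‖} := by
    intro x _
    rcases eq_or_ne x 0 with rfl | hx
    · exact Or.inl rfl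
    · refine Or.inr (mem_iUnion.2 ?_)
      obtain ⟨n, hn⟩ := exists_nat_one_div_lt (norm_pos_iff.2 hx)
      exact ⟨n, by simpa using hn⟩
  refine (measure_mono hcov).trans ((measure_union_le _ _).trans ?_)
  rw [h.isM0.zero_singleton, zero_add]
  refine (measure_iUnion_le _).trans (le_of_eq (ENNReal.tsum_eq_zero.2 fun n => ?_))
  have hn : (0 : ℝ) < ((n : ℝ) + 1)⁻¹ := by positivity
  have h1 := congrArg (fun m => m univ) (h.map_angle_restrict hn)
  simp only [Measure.smul_apply, smul_eq_mul, h0, mul_zero] at h1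
  rwa [Measure.map_apply measurable_angle MeasurableSet.univ, preimage_univ,
    Measure.restrict_apply_univ] at h1

lemma angularMeasure_eq (μ : Measure H) :
    angularMeasure μ = (spectralMeasure μ univ)⁻¹ • spectralMeasure μ := by
  rw [angularMeasure, ProbabilityTheory.cond, Measure.map_smul, spectralMeasure,
    Measure.map_apply measurable_angle MeasurableSet.univ, preimage_univ,
    Measure.restrict_apply_univ]

lemma ae_norm_le_one_spectralMeasure (μ : Measure H) : ∀ᵐ x ∂(spectralMeasure μ), ‖x‖ ≤ 1 := by
  rw [spectralMeasure, ae_map_iff measurable_angle.aemeasurable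
    (measurableSet_le measurable_norm measurable_const)]
  exact ae_of_all _ fun x => norm_angle_le x

lemma IsRegularlyVarying.setIntegral_angle (h : IsRegularlyVarying P X α μ) {c : ℝ}
    (hc : 0 < c) {g : H → ℝ} (hg : Continuous g) :
    ∫ x in {x | c < ‖x‖}, g (angle x) ∂μ = c ^ (-α) * ∫ x, g x ∂(spectralMeasure μ) := by
  have h2 : SecondCountableTopology H := UniformSpace.secondCountable_of_separable H
  rw [← integral_map (f := g) measurable_angle.aemeasurable hg.aestronglyMeasurable,
    h.map_angle_restrict hc, integral_smul_measure, ENNReal.toReal_ofReal (by positivity),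
    smul_eq_mul]

lemma integrable_of_continuous_of_bound (h : IsRegularlyVarying P X α μ) {g : H → ℝ}
    (hg : Continuous g) {M : ℝ} (hM : ∀ x, ‖x‖ ≤ 1 → |g x| ≤ M) {c : ℝ} (hc : 0 < c) :
    IntegrableOn (fun x => g (angle x)) {x | c < ‖x‖} μ := by
  refine Measure.integrableOn_of_bounded (h.measure_lt_norm_lt_top hc).ne
    (hg.measurable.comp measurable_angle).aestronglyMeasurable (M := M)
    (ae_of_all _ fun x => hM _ (norm_angle_le x))

end LimitMeasure

/-! ### Scalar tail limits along real thresholds. -/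

section Tail

variable {H : Type*} [NormedAddCommGroup H] [InnerProductSpace ℝ H]
  [TopologicalSpace.SeparableSpace H] [MeasurableSpace H] [BorelSpace H]
  {Ω : Type*} [MeasurableSpace Ω] {P : Measure Ω} {X : Ω → H} {α : ℝ} {μ : Measure H}

lemma tendsto_integral_cutoffAngle (hX : Measurable X) {b : ℝ → ℝ}
    (hb : TendstoM0 (fun n : ℕ => ENNReal.ofReal (b n) • P.map (fun ω => (n : ℝ)⁻¹ • X ω)) μ)
    {lo hi : ℝ} (hlo : 0 < lo) (hlh : lo < hi) {g : H → ℝ} (hg : Continuous g)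
    {M : ℝ} (hM : ∀ x, ‖x‖ ≤ 1 → |g x| ≤ M) :
    Tendsto (fun n : ℕ => max (b n) 0 *
      ∫ ω, cutoff lo hi ((n : ℝ)⁻¹ * ‖X ω‖) * g (angle ((n : ℝ)⁻¹ • X ω)) ∂P) atTop
      (𝓝 (∫ x, cutoff lo hi ‖x‖ * g (angle x) ∂μ)) := by
  have h2 : SecondCountableTopology H := UniformSpace.secondCountable_of_separable H
  have h := hb (cutoffAngle hlo hlh hg hM) ⟨lo, hlo, fun x hx => by
    rw [cutoffAngle_apply, cutoff_eq_zero hlh hx.le, zero_mul]⟩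
  refine h.congr fun n => ?_
  have hm : Measurable fun ω => (n : ℝ)⁻¹ • X ω := hX.const_smul _
  rw [integral_smul_measure, integral_map hm.aemeasurable
    (cutoffAngle hlo hlh hg hM).continuous.aestronglyMeasurable, ENNReal.toReal_ofReal',
    smul_eq_mul]
  simp only [cutoffAngle_apply, norm_smul, norm_inv, Real.norm_natCast]

variable [IsProbabilityMeasure P]

/-- Tail behaviour of the angle, for events between `{‖X‖ > t}` and `{‖X‖ ≥ t}`. -/
lemma tendsto_integral_indicator_angle_of_nonneg (hX : Measurable X)
    (h : IsRegularlyVarying P X α μ) {b : ℝ → ℝ}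
    (hb : TendstoM0 (fun n : ℕ => ENNReal.ofReal (b n) • P.map (fun ω => (n : ℝ)⁻¹ • X ω)) μ)
    {U : ℝ → Set H} (hU : ∀ t, MeasurableSet (U t)) (hU1 : ∀ t, {x | t < ‖x‖} ⊆ U t)
    (hU2 : ∀ t, U t ⊆ {x | t ≤ ‖x‖}) {g : H → ℝ} (hg : Continuous g)
    {M : ℝ} (hM : ∀ x, ‖x‖ ≤ 1 → |g x| ≤ M) (hg0 : ∀ x, ‖x‖ ≤ 1 → 0 ≤ g x) :
    Tendsto (fun t : ℝ => max (b ⌊t⌋₊) 0 *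
      ∫ ω, (U t).indicator (fun x => g (angle x)) (X ω) ∂P) atTop
      (𝓝 (∫ x, g x ∂(spectralMeasure μ))) := by
  have h2 : SecondCountableTopology H := UniformSpace.secondCountable_of_separable H
  set L := ∫ x, g x ∂(spectralMeasure μ) with hL
  have hga : ∀ x, 0 ≤ g (angle x) := fun x => hg0 _ (norm_angle_le x)
  have hgm : Measurable fun x : H => g (angle x) := hg.measurable.comp measurable_angle
  have hUi : ∀ t, Integrable (fun ω => (U t).indicator (fun x => g (angle x)) (X ω)) P :=
    fun t => by
      refine Integrable.of_bound ((hgm.indicator (hU t)).comp hX).aestronglyMeasurable M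
        (ae_of_all _ fun ω => ?_)
      exact (norm_indicator_le_norm_self _ _).trans (hM _ (norm_angle_le _))
  have hci : ∀ lo hi (n : ℕ), Integrable (fun ω =>
      cutoff lo hi ((n : ℝ)⁻¹ * ‖X ω‖) * g (angle ((n : ℝ)⁻¹ • X ω))) P := fun lo hi n => by
    refine Integrable.of_bound (Measurable.aestronglyMeasurable ?_) M (ae_of_all _ fun ω => ?_)
    · exact ((continuous_cutoff lo hi).measurable.comp (hX.norm.const_mul _)).mul
        (hgm.comp (hX.const_smul _))
    · rw [norm_mul, Real.norm_of_nonneg (cutoff_nonneg _ _ _)]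
      exact (mul_le_of_le_one_left (norm_nonneg _) (cutoff_le_one _ _ _)).trans
        (hM _ (norm_angle_le _))
  have hfi : ∀ {lo hi : ℝ}, 0 < lo → lo < hi →
      Integrable (fun x => cutoff lo hi ‖x‖ * g (angle x)) μ := fun {lo hi} hlo hlh => by
    refine ((integrable_indicator_iff (measurableSet_lt_norm lo)).2
      (integrable_of_continuous_of_bound h hg hM hlo)).mono
      (Measurable.aestronglyMeasurable ?_) (ae_of_all _ fun x => ?_)
    · exact ((continuous_cutoff lo hi).measurable.comp measurable_norm).mul hgm
    · by_cases hx : lo < ‖x‖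
      · rw [indicator_of_mem (by exact hx), norm_mul, Real.norm_of_nonneg (cutoff_nonneg _ _ _)]
        exact mul_le_of_le_one_left (norm_nonneg _) (cutoff_le_one _ _ _)
      · rw [cutoff_eq_zero hlh (not_lt.1 hx), zero_mul, norm_zero]
        exact norm_nonneg _
  have hfloor : ∀ᶠ t : ℝ in atTop, (1 : ℕ) ≤ ⌊t⌋₊ := by
    filter_upwards [eventually_ge_atTop 1] with t ht
    exact Nat.le_floor (by simpa using ht)
  rw [tendsto_order]
  constructor
  -- Lower bound: a cutoff rising between `1 + ε` and `1 + 2ε` lies below the indicator. The margin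
  -- `ε` absorbs the gap between `t` and `⌊t⌋₊`, since `ε ⌊t⌋₊ ≥ 1` once `t ≥ 1 + ε⁻¹`.
  · intro a ha
    have hcont : Tendsto (fun ε : ℝ => (1 + 2 * ε) ^ (-α) * L) (𝓝[>] 0) (𝓝 L) := by
      have : ContinuousAt (fun ε : ℝ => (1 + 2 * ε) ^ (-α) * L) 0 :=
        (ContinuousAt.rpow_const (by fun_prop) (Or.inl (by norm_num))).mul continuousAt_const
      simpa using this.tendsto.mono_left nhdsWithin_le_nhds
    obtain ⟨ε, hε1, hε⟩ := ((hcont.eventually (lt_mem_nhds ha)).and self_mem_nhdsWithin).exists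
    have hε0 : 0 < ε := hε
    have hlo : 0 < 1 + ε := by linarith
    have hlh : 1 + ε < 1 + 2 * ε := by linarith
    have hlow : a < ∫ x, cutoff (1 + ε) (1 + 2 * ε) ‖x‖ * g (angle x) ∂μ := by
      refine hε1.trans_le ?_
      rw [← h.setIntegral_angle (by linarith) hg,
        ← integral_indicator (measurableSet_lt_norm (1 + 2 * ε))]
      refine integral_mono_of_nonneg (ae_of_all _ fun x => indicator_nonneg (fun y _ => hga y) x)
        (hfi hlo hlh) (ae_of_all _ fun x => ?_)
      by_cases hx : 1 + 2 * ε < ‖x‖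
      · simp only
        rw [indicator_of_mem (by exact hx), cutoff_eq_one hlh hx.le, one_mul]
      · rw [indicator_of_notMem (by exact hx)]
        exact mul_nonneg (cutoff_nonneg _ _ _) (hga x)
    have hlim := (tendsto_integral_cutoffAngle hX hb hlo hlh hg hM).comp
      (tendsto_nat_floor_atTop (α := ℝ))
    filter_upwards [hlim.eventually (lt_mem_nhds hlow), hfloor, eventually_ge_atTop (1 + ε⁻¹)]
      with t ht ht1 ht2
    refine ht.trans_le ?_
    have hn0 : (0 : ℝ) < ⌊t⌋₊ := by exact_mod_cast ht1
    refine mul_le_mul_of_nonneg_left ?_ (le_max_right _ _)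
    refine integral_mono (hci _ _ _) (hUi t) fun ω => ?_
    by_cases hx : 1 + ε < (⌊t⌋₊ : ℝ)⁻¹ * ‖X ω‖
    · have hxt : t < ‖X ω‖ := by
        rw [lt_inv_mul_iff₀ hn0] at hx
        have h3 := Nat.lt_floor_add_one t
        have h4 : 1 ≤ ⌊t⌋₊ * ε := by
          have : ε⁻¹ ≤ (⌊t⌋₊ : ℝ) := by linarith
          calc (1 : ℝ) = ε⁻¹ * ε := (inv_mul_cancel₀ hε0.ne').symm
            _ ≤ _ := by gcongr
        nlinarith
      rw [indicator_of_mem (hU1 t hxt), angle_smul (inv_pos.2 hn0)]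
      exact mul_le_of_le_one_left (hga _) (cutoff_le_one _ _ _)
    · simp only
      rw [cutoff_eq_zero hlh (not_lt.1 hx), zero_mul]
      exact indicator_nonneg (fun y _ => hga y) _
  -- Upper bound: a cutoff rising between `1 - ε` and `1` dominates the indicator. No margin for
  -- rounding is needed here, because `⌊t⌋₊ ≤ t`.
  · intro a ha
    have hcont : Tendsto (fun ε : ℝ => (1 - ε) ^ (-α) * L) (𝓝[>] 0) (𝓝 L) := by
      have : ContinuousAt (fun ε : ℝ => (1 - ε) ^ (-α) * L) 0 :=
        (ContinuousAt.rpow_const (by fun_prop) (Or.inl (by norm_num))).mul continuousAt_const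
      simpa using this.tendsto.mono_left nhdsWithin_le_nhds
    obtain ⟨ε, hε1, hε⟩ := ((hcont.eventually (gt_mem_nhds ha)).and
      (Ioo_mem_nhdsGT (one_pos (α := ℝ)))).exists
    have hlo : 0 < 1 - ε := by linarith [hε.2]
    have hlh : 1 - ε < 1 := by linarith [hε.1]
    have hup : ∫ x, cutoff (1 - ε) 1 ‖x‖ * g (angle x) ∂μ < a := by
      refine lt_of_le_of_lt ?_ hε1
      rw [← h.setIntegral_angle hlo hg, ← integral_indicator (measurableSet_lt_norm (1 - ε))]
      refine integral_mono (hfi hlo hlh) ((integrable_indicator_iff (measurableSet_lt_norm _)).2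
        (integrable_of_continuous_of_bound h hg hM hlo)) fun x => ?_
      by_cases hx : 1 - ε < ‖x‖
      · rw [indicator_of_mem (by exact hx)]
        exact mul_le_of_le_one_left (hga x) (cutoff_le_one _ _ _)
      · rw [indicator_of_notMem (by exact hx)]
        simp only
        rw [cutoff_eq_zero hlh (not_lt.1 hx), zero_mul]
    have hlim := (tendsto_integral_cutoffAngle hX hb hlo hlh hg hM).comp
      (tendsto_nat_floor_atTop (α := ℝ))
    filter_upwards [hlim.eventually (gt_mem_nhds hup), hfloor, eventually_ge_atTop 0]
      with t ht ht1 ht0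
    refine lt_of_le_of_lt ?_ ht
    have hn0 : (0 : ℝ) < ⌊t⌋₊ := by exact_mod_cast ht1
    refine mul_le_mul_of_nonneg_left ?_ (le_max_right _ _)
    refine integral_mono (hUi t) (hci _ _ _) fun ω => ?_
    by_cases hx : X ω ∈ U t
    · have h3 : (1 : ℝ) ≤ (⌊t⌋₊ : ℝ)⁻¹ * ‖X ω‖ := by
        rw [le_inv_mul_iff₀ hn0, mul_one]
        exact (Nat.floor_le ht0).trans (hU2 t hx)
      rw [indicator_of_mem hx, angle_smul (inv_pos.2 hn0)]
      simp only
      rw [cutoff_eq_one hlh h3, one_mul]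
    · rw [indicator_of_notMem hx]
      exact mul_nonneg (cutoff_nonneg _ _ _) (hga _)

end Tail

/-! ### Finite-dimensional truncation along a Hilbert basis. -/

section Truncation

variable {H : Type*} [NormedAddCommGroup H] [InnerProductSpace ℝ H] {ι : Type*}

/-- The orthogonal projection on the span of finitely many vectors of a Hilbert basis. -/
def truncate (b : HilbertBasis ι ℝ H) (s : Finset ι) (x : H) : H :=
  ∑ i ∈ s, inner ℝ (b i) x • b i

lemma continuous_truncate (b : HilbertBasis ι ℝ H) (s : Finset ι) : Continuous (truncate b s) := by
  unfold truncate; fun_prop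

lemma norm_truncate_le (b : HilbertBasis ι ℝ H) (s : Finset ι) (x : H) :
    ‖truncate b s x‖ ≤ ‖x‖ := by
  refine le_of_sq_le_sq ?_ (norm_nonneg _)
  have h := b.orthonormal.sum_inner_products_le x (s := s)
  rw [← real_inner_self_eq_norm_sq, truncate, b.orthonormal.inner_sum]
  simpa [sq] using h

lemma tendsto_truncate (b : HilbertBasis ι ℝ H) (x : H) :
    Tendsto (fun s => truncate b s x) atTop (𝓝 x) := by
  have h := b.hasSum_repr x
  simp only [b.repr_apply_apply] at h
  exact h

lemma tens_truncate (b : HilbertBasis ι ℝ H) (s : Finset ι) (x : H) :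
    tens b (truncate b s x) (truncate b s x) =
      ∑ k ∈ s ×ˢ s, (inner ℝ (b k.1) x * inner ℝ (b k.2) x) • tens b (b k.1) (b k.2) := by
  rw [Finset.sum_product_right, truncate, map_sum]
  refine Finset.sum_congr rfl fun j _ => ?_
  rw [map_smul, map_sum, _root_.sum_apply, Finset.smul_sum]
  refine Finset.sum_congr rfl fun i _ => ?_
  rw [map_smul, smul_apply, smul_smul, mul_comm]

end Truncation

/-! ### Convergence of `C_t` in Hilbert-Schmidt norm. -/

section AngularLimit

lemma countable_of_hilbertBasis {H : Type*} [NormedAddCommGroup H] [InnerProductSpace ℝ H]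
    [TopologicalSpace.SeparableSpace H] {ι : Type*} (b : HilbertBasis ι ℝ H) : Countable ι := by
  refine Pairwise.countable_of_isOpen_disjoint (s := fun i => Metric.ball (b i) (1 / 2))
    (fun i j hij => ?_) (fun i => Metric.isOpen_ball) (fun i => ⟨b i, by simp⟩)
  refine Metric.ball_disjoint_ball ?_
  have h1 : ‖b i - b j‖ ^ 2 = 2 := by
    rw [norm_sub_sq_real, b.orthonormal.1, b.orthonormal.1, b.orthonormal.2 hij]
    norm_num
  rw [dist_eq_norm]
  nlinarith [norm_nonneg (b i - b j)]

variable {H : Type*} [NormedAddCommGroup H] [InnerProductSpace ℝ H]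
  [TopologicalSpace.SeparableSpace H] [MeasurableSpace H] [BorelSpace H]
  {Ω : Type*} [MeasurableSpace Ω] {P : Measure Ω} {X : Ω → H} {α : ℝ} {μ : Measure H}

lemma integrable_spectralMeasure {E : Type*} [NormedAddCommGroup E]
    (h : IsRegularlyVarying P X α μ) {g : H → E} (hg : Continuous g) {M : ℝ}
    (hM : ∀ x, ‖x‖ ≤ 1 → ‖g x‖ ≤ M) : Integrable g (spectralMeasure μ) := by
  have h2 : SecondCountableTopology H := UniformSpace.secondCountable_of_separable H
  have := h.isFiniteMeasure
  refine Integrable.of_bound hg.stronglyMeasurable.aestronglyMeasurable M ?_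
  filter_upwards [ae_norm_le_one_spectralMeasure μ] with x hx using hM x hx

lemma IsRegularlyVarying.isProbabilityMeasure_angularMeasure (h : IsRegularlyVarying P X α μ) :
    IsProbabilityMeasure (angularMeasure μ) := by
  have hfin := h.isFiniteMeasure
  refine ⟨?_⟩
  rw [angularMeasure_eq, Measure.smul_apply, smul_eq_mul,
    ENNReal.inv_mul_cancel h.spectralMeasure_univ_ne_zero (measure_ne_top _ _)]

lemma represents_limitCov [CompleteSpace H] {ι : Type*} (e : HilbertBasis ι ℝ H)
    (h : IsRegularlyVarying P X α μ) :
    Represents e (((spectralMeasure μ).real univ)⁻¹ • ∫ x, tens e x x ∂(spectralMeasure μ))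
      (limitCov μ) := by
  have hp := h.isProbabilityMeasure_angularMeasure
  have h1 := represents_integral e (Q := angularMeasure μ) measurable_id (by
    rw [angularMeasure_eq]
    exact Measure.ae_smul_measure (ae_norm_le_one_spectralMeasure μ) _)
  simp only [id] at h1
  rw [limitCov]
  convert! h1 using 1
  rw [angularMeasure_eq, integral_smul_measure, ENNReal.toReal_inv, measureReal_def]

variable [IsProbabilityMeasure P]

lemma integrable_indicator_angle {E : Type*} [NormedAddCommGroup E]
    (hX : Measurable X) {U : Set H} (hU : MeasurableSet U) {g : H → E} (hg : Continuous g) {M : ℝ}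
    (hM : ∀ x, ‖x‖ ≤ 1 → ‖g x‖ ≤ M) :
    Integrable (fun ω => U.indicator (fun x => g (angle x)) (X ω)) P := by
  have h2 : SecondCountableTopology H := UniformSpace.secondCountable_of_separable H
  have hm : StronglyMeasurable fun x => g (angle x) :=
    hg.stronglyMeasurable.comp_measurable measurable_angle
  refine Integrable.of_bound ((hm.indicator hU).comp_measurable hX).aestronglyMeasurable M
    (ae_of_all _ fun ω => ?_)
  exact (norm_indicator_le_norm_self _ _).trans (hM _ (norm_angle_le _))

lemma tendsto_integral_indicator_angle (hX : Measurable X)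
    (h : IsRegularlyVarying P X α μ) {b : ℝ → ℝ}
    (hb : TendstoM0 (fun n : ℕ => ENNReal.ofReal (b n) • P.map (fun ω => (n : ℝ)⁻¹ • X ω)) μ)
    {g : H → ℝ} (hg : Continuous g) {M : ℝ} (hM : ∀ x, ‖x‖ ≤ 1 → |g x| ≤ M) :
    Tendsto (fun t : ℝ => max (b ⌊t⌋₊) 0 *
      ∫ ω, {x | t < ‖x‖}.indicator (fun x => g (angle x)) (X ω) ∂P) atTop
      (𝓝 (∫ x, g x ∂(spectralMeasure μ))) := by
  have hfin := h.isFiniteMeasure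
  have hM0 : 0 ≤ M := (abs_nonneg _).trans (hM 0 (by simp))
  have key : ∀ {f : H → ℝ}, Continuous f → ∀ {K : ℝ}, (∀ x, ‖x‖ ≤ 1 → |f x| ≤ K) →
      (∀ x, ‖x‖ ≤ 1 → 0 ≤ f x) → _ := fun hf _ hK hf0 =>
    tendsto_integral_indicator_angle_of_nonneg hX h hb measurableSet_lt_norm
      (fun t => Subset.rfl) (fun t x (hx : t < ‖x‖) => mem_ofPred_eq ▸ hx.le) hf hK hf0
  -- The sandwich argument needs nonnegative functions, so `g` is written as `(g + M) - M`.
  have h1 := key (f := fun x => g x + M) (by fun_prop) (K := M + M)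
    (fun x hx => (abs_add_le _ _).trans (add_le_add (hM x hx) (abs_of_nonneg hM0).le))
    (fun x hx => by linarith [(abs_le.1 (hM x hx)).1])
  have h2 := key (f := fun _ => M) continuous_const (K := M)
    (fun x hx => (abs_of_nonneg hM0).le) (fun x hx => hM0)
  have h3 := h1.sub h2
  rw [← integral_sub (integrable_spectralMeasure h (by fun_prop) (M := M + M)
    (fun x hx => (abs_add_le _ _).trans (add_le_add (hM x hx) (abs_of_nonneg hM0).le)))
    (integrable_const M)] at h3
  simp only [add_sub_cancel_right] at h3
  refine h3.congr fun t => ?_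
  rw [← mul_sub, ← integral_sub
    (integrable_indicator_angle (g := fun x => g x + M) hX (measurableSet_lt_norm t) (by fun_prop)
      (M := M + M)
      (fun x hx => (abs_add_le _ _).trans (add_le_add (hM x hx) (abs_of_nonneg hM0).le)))
    (integrable_indicator_angle (g := fun _ => M) hX (measurableSet_lt_norm t) continuous_const
      (M := M) (fun x hx => (abs_of_nonneg hM0).le))]
  congr 2
  ext ω
  simp only [indicator_apply]
  split_ifs <;> ring

lemma tendsto_integral_indicator_angle_sum {E κ : Type*} [NormedAddCommGroup E] [NormedSpace ℝ E]
    [CompleteSpace E] (hX : Measurable X) (h : IsRegularlyVarying P X α μ) {b : ℝ → ℝ}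
    (hb : TendstoM0 (fun n : ℕ => ENNReal.ofReal (b n) • P.map (fun ω => (n : ℝ)⁻¹ • X ω)) μ)
    (s : Finset κ) {g : κ → H → ℝ} (hg : ∀ k, Continuous (g k)) {M : ℝ}
    (hM : ∀ k x, ‖x‖ ≤ 1 → |g k x| ≤ M) (v : κ → E) :
    Tendsto (fun t : ℝ => max (b ⌊t⌋₊) 0 •
      ∫ ω, {x | t < ‖x‖}.indicator (fun x => ∑ k ∈ s, g k (angle x) • v k) (X ω) ∂P) atTop
      (𝓝 (∫ x, ∑ k ∈ s, g k x • v k ∂(spectralMeasure μ))) := by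
  have h1 := tendsto_finsetSum s fun k (_ : k ∈ s) =>
    (tendsto_integral_indicator_angle hX h hb (hg k) (hM k)).smul_const (v k)
  rw [integral_finsetSum _ fun k _ =>
    (integrable_spectralMeasure h (hg k) (hM k)).smul_const (v k)]
  simp only [integral_smul_const]
  refine h1.congr fun t => ?_
  have h2 : ∀ ω, {x | t < ‖x‖}.indicator (fun x => ∑ k ∈ s, g k (angle x) • v k) (X ω) =
      ∑ k ∈ s, {x | t < ‖x‖}.indicator (fun x => g k (angle x)) (X ω) • v k := fun ω => by
    simp only [indicator_apply]
    split_ifs <;> simp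
  simp only [h2]
  rw [integral_finsetSum _ fun k _ => (integrable_indicator_angle hX (measurableSet_lt_norm t)
    (hg k) (hM k)).smul_const (v k), Finset.smul_sum]
  simp only [integral_smul_const, smul_smul]

variable {ι : Type*}

/-- For the truncated tensor, a finite sum of scalar functions times fixed vectors, scalar
convergence suffices. The truncation error `d s` is itself a continuous scalar function, bounded on
the unit ball, so its tail mean converges to its integral under the limit, which is small for large
`s`. This replaces a tightness argument. -/
lemma tendsto_exceedMean [CompleteSpace H] (e : HilbertBasis ι ℝ H) (hX : Measurable X)
    (h : IsRegularlyVarying P X α μ) {b : ℝ → ℝ}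
    (hb : TendstoM0 (fun n : ℕ => ENNReal.ofReal (b n) • P.map (fun ω => (n : ℝ)⁻¹ • X ω)) μ) :
    Tendsto (fun t : ℝ => max (b ⌊t⌋₊) 0 • exceedMean e P X t) atTop
      (𝓝 (∫ x, tens e x x ∂(spectralMeasure μ))) := by
  -- Countability of `ι` makes `atTop` on `Finset ι` countably generated, as dominated convergence
  -- requires.
  have := countable_of_hilbertBasis e
  have hfin := h.isFiniteMeasure
  have hc := continuous_tens_self e
  have hcs : ∀ s, Continuous fun x => tens e (truncate e s x) (truncate e s x) := fun s =>
    hc.comp (continuous_truncate e s)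
  have hb1 : ∀ x : H, ‖x‖ ≤ 1 → ‖tens e x x‖ ≤ 1 := fun x hx => by
    rw [norm_tens_self]; exact pow_le_one₀ (norm_nonneg _) hx
  have hbs : ∀ s (x : H), ‖x‖ ≤ 1 → ‖tens e (truncate e s x) (truncate e s x)‖ ≤ 1 :=
    fun s x hx => hb1 _ ((norm_truncate_le e s x).trans hx)
  set d : Finset ι → H → ℝ := fun s x =>
    ‖tens e x x - tens e (truncate e s x) (truncate e s x)‖ with hd
  have hdc : ∀ s, Continuous (d s) := fun s => (hc.sub (hcs s)).norm
  have hdb : ∀ s (x : H), ‖x‖ ≤ 1 → |d s x| ≤ 2 := fun s x hx => by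
    rw [hd, abs_norm]
    exact (norm_sub_le _ _).trans (by linarith [hb1 x hx, hbs s x hx])
  have hdlim : Tendsto (fun s => ∫ x, d s x ∂(spectralMeasure μ)) atTop (𝓝 0) := by
    have h1 := tendsto_integral_filter_of_dominated_convergence (μ := spectralMeasure μ)
      (F := d) (f := fun _ => (0 : ℝ)) (l := atTop) (fun _ => (2 : ℝ))
      (Eventually.of_forall fun s => (integrable_spectralMeasure h (hdc s) (hdb s)).1)
      (Eventually.of_forall fun s => by
        filter_upwards [ae_norm_le_one_spectralMeasure μ] with x hx using hdb s x hx)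
      (integrable_const 2)
      (ae_of_all _ fun x => by
        have h2 := ((hc.tendsto x).comp (tendsto_truncate e x)).const_sub (tens e x x)
        simpa [hd] using h2.norm)
    simpa using h1
  rw [Metric.tendsto_atTop']
  intro δ hδ
  obtain ⟨s, hs⟩ := (hdlim.eventually (gt_mem_nhds (by positivity : 0 < δ / 3))).exists
  have hl1 := tendsto_integral_indicator_angle hX h hb (hdc s) (hdb s)
  have hl2 := tendsto_integral_indicator_angle_sum hX h hb (s ×ˢ s)
    (g := fun k x => inner ℝ (e k.1) x * inner ℝ (e k.2) x) (fun k => by fun_prop) (M := 1)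
    (fun k x hx => by
      have h1 : ∀ i, |inner ℝ (e i) x| ≤ 1 := fun i => by
        refine (abs_real_inner_le_norm _ _).trans ?_
        rw [e.orthonormal.1, one_mul]; exact hx
      rw [abs_mul]
      exact mul_le_one₀ (h1 _) (abs_nonneg _) (h1 _))
    (fun k => tens e (e k.1) (e k.2))
  simp only [← tens_truncate] at hl2
  have hev := (hl1.eventually (gt_mem_nhds hs)).and
    (hl2.eventually (Metric.ball_mem_nhds _ (by positivity : 0 < δ / 3)))
  obtain ⟨N, hN⟩ := eventually_atTop.1 hev
  refine ⟨N, fun t ht => ?_⟩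
  obtain ⟨h1, h2⟩ := hN t ht.le
  rw [dist_eq_norm] at h2 ⊢
  set a := max (b ⌊t⌋₊) 0 with ha
  have ha0 : 0 ≤ a := le_max_right _ _
  set Is := ∫ ω, {x | t < ‖x‖}.indicator
    (fun x => tens e (truncate e s (angle x)) (truncate e s (angle x))) (X ω) ∂P with hIs
  set Js := ∫ x, tens e (truncate e s x) (truncate e s x) ∂(spectralMeasure μ) with hJs
  have h3 : ‖a • exceedMean e P X t - a • Is‖ ≤
      a * ∫ ω, {x | t < ‖x‖}.indicator (fun x => d s (angle x)) (X ω) ∂P := by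
    rw [← smul_sub, norm_smul, Real.norm_of_nonneg ha0]
    gcongr
    rw [exceedMean, hIs]
    unfold angleTens
    rw [← integral_sub (integrable_indicator_angle (g := fun x => tens e x x) hX
      (measurableSet_lt_norm t) hc hb1)
      (integrable_indicator_angle (g := fun x => tens e (truncate e s x) (truncate e s x)) hX
      (measurableSet_lt_norm t) (hcs s) (hbs s))]
    refine (norm_integral_le_integral_norm _).trans (le_of_eq ?_)
    congr 1
    ext ω
    simp only [indicator_apply, hd]
    split_ifs <;> simp
  have h4 : ‖Js - ∫ x, tens e x x ∂(spectralMeasure μ)‖ ≤ ∫ x, d s x ∂(spectralMeasure μ) := by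
    rw [norm_sub_rev, hJs, ← integral_sub (integrable_spectralMeasure h hc hb1)
      (integrable_spectralMeasure h (hcs s) (hbs s))]
    exact norm_integral_le_integral_norm _
  have h5 : a • exceedMean e P X t - ∫ x, tens e x x ∂(spectralMeasure μ) =
      (a • exceedMean e P X t - a • Is) + (a • Is - Js) +
        (Js - ∫ x, tens e x x ∂(spectralMeasure μ)) := by abel
  rw [h5]
  refine (norm_add₃_le).trans_lt ?_
  linarith

/-- Consequences of regular variation for the tail of the norm and for the angle. -/
lemma IsRegularlyVarying.tail [CompleteSpace H] (e : HilbertBasis ι ℝ H) (hX : Measurable X)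
    (h : IsRegularlyVarying P X α μ) :
    (∀ᶠ t : ℝ in atTop, 0 < P.real {ω | t < ‖X ω‖}) ∧
    Tendsto (fun t : ℝ => P.real {ω | t < ‖X ω‖} / P.real {ω | t ≤ ‖X ω‖}) atTop (𝓝 1) ∧
    Tendsto (fun t : ℝ => (P.real {ω | t < ‖X ω‖})⁻¹ • exceedMean e P X t) atTop
      (𝓝 (((spectralMeasure μ).real univ)⁻¹ • ∫ x, tens e x x ∂(spectralMeasure μ))) := by
  obtain ⟨b, ρ, -, hb⟩ := h.tendsto
  have hfin := h.isFiniteMeasure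
  set m := (spectralMeasure μ).real univ with hm
  have hm0 : 0 < m :=
    ENNReal.toReal_pos h.spectralMeasure_univ_ne_zero (measure_ne_top _ _)
  have hlt : Tendsto (fun t : ℝ => max (b ⌊t⌋₊) 0 * P.real {ω | t < ‖X ω‖}) atTop (𝓝 m) := by
    have h1 := tendsto_integral_indicator_angle hX h hb (g := fun _ => 1) continuous_const (M := 1)
      (fun x _ => by simp)
    simp only [integral_const, smul_eq_mul, mul_one] at h1
    refine h1.congr fun t => ?_
    rw [integral_indicator_one_comp hX (measurableSet_lt_norm t)]
    rfl
  have hle : Tendsto (fun t : ℝ => max (b ⌊t⌋₊) 0 * P.real {ω | t ≤ ‖X ω‖}) atTop (𝓝 m) := by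
    have hms : ∀ t : ℝ, MeasurableSet {x : H | t ≤ ‖x‖} := fun t =>
      measurableSet_le measurable_const measurable_norm
    have h1 := tendsto_integral_indicator_angle_of_nonneg hX h hb hms
      (fun t x (hx : t < ‖x‖) => mem_ofPred_eq ▸ hx.le) (fun t => Subset.rfl) (g := fun _ => 1)
      continuous_const (M := 1) (fun x _ => by simp) (fun x _ => by simp)
    simp only [integral_const, smul_eq_mul, mul_one] at h1
    refine h1.congr fun t => ?_
    rw [integral_indicator_one_comp hX (hms t)]
    rfl
  have hpos : ∀ᶠ t : ℝ in atTop, 0 < max (b ⌊t⌋₊) 0 * P.real {ω | t < ‖X ω‖} :=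
    hlt.eventually (lt_mem_nhds hm0)
  refine ⟨?_, ?_, ?_⟩
  · filter_upwards [hpos] with t ht
    exact pos_of_mul_pos_right ht (le_max_right _ _)
  -- The strict and the weak tail have the same limit `m` under the same normalisation, which
  -- cancels in the quotient.
  · have h1 := hlt.div hle hm0.ne'
    rw [div_self hm0.ne'] at h1
    refine h1.congr' ?_
    filter_upwards [hpos] with t ht
    have ha := pos_of_mul_pos_left ht measureReal_nonneg
    simp only [Pi.div_apply]
    rw [mul_div_mul_left _ _ ha.ne']
  · have h1 := (hlt.inv₀ hm0.ne').smul (tendsto_exceedMean e hX h hb)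
    refine h1.congr' ?_
    filter_upwards [hpos] with t ht
    have ha := pos_of_mul_pos_left ht measureReal_nonneg
    rw [smul_smul, mul_inv, mul_comm (max _ _)⁻¹, mul_assoc, inv_mul_cancel₀ ha.ne', mul_one]

end AngularLimit

/-! ### Consistency of the empirical eigenspaces. -/

section Consistency

/-- Existence of upper quantiles. -/
lemma exists_upper_quantile {Ω : Type*} [MeasurableSpace Ω] {P : Measure Ω}
    [IsProbabilityMeasure P] {R : Ω → ℝ} (hR : Measurable R) (hR0 : ∀ ω, 0 ≤ R ω) {q : ℝ}
    (hq0 : 0 < q) (hq1 : q ≤ 1) :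
    ∃ s, P.real {ω | s < R ω} ≤ q ∧ q ≤ P.real {ω | s ≤ R ω} := by
  have hms : ∀ s, MeasurableSet {ω | s < R ω} := fun s => measurableSet_lt measurable_const hR
  have hu : Tendsto (fun j : ℕ => 1 / ((j : ℝ) + 1)) atTop (𝓝 0) :=
    tendsto_one_div_add_atTop_nhds_zero_nat
  have hupos : ∀ j : ℕ, 0 < 1 / ((j : ℝ) + 1) := fun j => by positivity
  have hanti : ∀ {i j : ℕ}, i ≤ j → 1 / ((j : ℝ) + 1) ≤ 1 / ((i : ℝ) + 1) := fun hij =>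
    one_div_le_one_div_of_le (by positivity) (by gcongr)
  set T := {s : ℝ | 0 ≤ s ∧ P.real {ω | s < R ω} ≤ q} with hT
  have hTb : BddBelow T := ⟨0, fun s hs => hs.1⟩
  have hTne : T.Nonempty := by
    have h1 : Tendsto (fun j : ℕ => P {ω | (j : ℝ) < R ω}) atTop
        (𝓝 (P (⋂ j : ℕ, {ω | (j : ℝ) < R ω}))) :=
      tendsto_measure_iInter_atTop (fun j => (hms j).nullMeasurableSet)
        (fun i j hij ω (hω : (j : ℝ) < R ω) =>
          show (i : ℝ) < R ω from lt_of_le_of_lt (by exact_mod_cast hij) hω)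
        ⟨0, measure_ne_top _ _⟩
    have h2 : (⋂ j : ℕ, {ω | (j : ℝ) < R ω}) = ∅ := by
      refine eq_empty_of_forall_notMem fun ω hω => ?_
      obtain ⟨j, hj⟩ := exists_nat_ge (R ω)
      exact absurd (mem_iInter.1 hω j) (not_lt.2 hj)
    rw [h2, measure_empty] at h1
    have h3 := (ENNReal.tendsto_toReal ENNReal.zero_ne_top).comp h1
    obtain ⟨j, hj⟩ := (h3.eventually (gt_mem_nhds (by simpa using hq0))).exists
    exact ⟨j, by positivity, le_of_lt hj⟩
  -- Continuity of `P` along increasing sets gives the first bound, along decreasing sets the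
  -- second. Below `0` the tail probability is `1 ≥ q`, so restricting `T` to `s ≥ 0` loses nothing.
  refine ⟨sInf T, ?_, ?_⟩
  · have h1 : Tendsto (fun j : ℕ => P {ω | sInf T + 1 / ((j : ℝ) + 1) < R ω}) atTop
        (𝓝 (P (⋃ j : ℕ, {ω | sInf T + 1 / ((j : ℝ) + 1) < R ω}))) :=
      tendsto_measure_iUnion_atTop fun i j hij ω (hω : _ < R ω) =>
        show _ < R ω from lt_of_le_of_lt (by gcongr) hω
    have h2 : (⋃ j : ℕ, {ω | sInf T + 1 / ((j : ℝ) + 1) < R ω}) = {ω | sInf T < R ω} := by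
      ext ω
      simp only [mem_iUnion, mem_ofPred_eq]
      refine ⟨fun ⟨j, hj⟩ => by linarith [hupos j], fun h => ?_⟩
      obtain ⟨j, hj⟩ := exists_nat_one_div_lt (sub_pos.2 h)
      exact ⟨j, by linarith⟩
    rw [h2] at h1
    refine le_of_tendsto' ((ENNReal.tendsto_toReal (measure_ne_top _ _)).comp h1) fun j => ?_
    obtain ⟨s, hs, hsj⟩ := exists_lt_of_csInf_lt hTne (lt_add_of_pos_right (sInf T) (hupos j))
    exact (measureReal_mono fun ω (hω : _ < R ω) => show s < R ω from hsj.trans hω).trans hs.2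
  · have h1 : Tendsto (fun j : ℕ => P {ω | sInf T - 1 / ((j : ℝ) + 1) < R ω}) atTop
        (𝓝 (P (⋂ j : ℕ, {ω | sInf T - 1 / ((j : ℝ) + 1) < R ω}))) :=
      tendsto_measure_iInter_atTop (fun j => (hms _).nullMeasurableSet)
        (fun i j hij ω (hω : _ < R ω) => show _ < R ω from lt_of_le_of_lt (by gcongr) hω)
        ⟨0, measure_ne_top _ _⟩
    have h2 : (⋂ j : ℕ, {ω | sInf T - 1 / ((j : ℝ) + 1) < R ω}) = {ω | sInf T ≤ R ω} := by
      ext ω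
      simp only [mem_iInter, mem_ofPred_eq]
      refine ⟨fun h => ?_, fun h j => by linarith [hupos j]⟩
      by_contra! hlt
      obtain ⟨j, hj⟩ := exists_nat_one_div_lt (sub_pos.2 hlt)
      linarith [h j]
    rw [h2] at h1
    refine ge_of_tendsto' ((ENNReal.tendsto_toReal (measure_ne_top _ _)).comp h1) fun j => ?_
    by_contra! hlt
    have hlt' : P.real {ω | sInf T - 1 / ((j : ℝ) + 1) < R ω} < q := hlt
    rcases lt_or_ge (sInf T - 1 / ((j : ℝ) + 1)) 0 with h0 | h0
    · have : {ω | sInf T - 1 / ((j : ℝ) + 1) < R ω} = univ :=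
        eq_univ_of_forall fun ω => h0.trans_le (hR0 ω)
      rw [this, probReal_univ] at hlt'
      linarith
    · have := csInf_le hTb (show sInf T - 1 / ((j : ℝ) + 1) ∈ T from ⟨h0, hlt'.le⟩)
      linarith [hupos j]

variable {H : Type*} [NormedAddCommGroup H] [InnerProductSpace ℝ H] [CompleteSpace H]
  [TopologicalSpace.SeparableSpace H] [MeasurableSpace H] [BorelSpace H]
  {Ω : Type*} [MeasurableSpace Ω] {P : Measure Ω} [IsProbabilityMeasure P]

/-- Consistency of the empirical angular operator, in Hilbert-Schmidt norm, with an exponential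
bound on the exceptional probabilities. -/
lemma eventually_exists_event_norm_empTens_sub_lt {ι : Type*} (e : HilbertBasis ι ℝ H)
    {X : Ω → H} (hX : Measurable X) {α : ℝ} {μ : Measure H} (hRV : IsRegularlyVarying P X α μ)
    {S : (n : ℕ) → Fin n → Ω → H} (hS : ∀ n, iIndepFun (S n) P)
    (hlaw : ∀ n i, IdentDistrib (S n i) X P P) {n k : ℕ → ℕ} (hn : Tendsto n atTop atTop)
    (hk : Tendsto k atTop atTop) (hkn : Tendsto (fun m => (k m : ℝ) / n m) atTop (𝓝 0))
    {η : ℝ} (hη : 0 < η) :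
    ∀ᶠ m in atTop, ∃ A : Set Ω,
      P.real Aᶜ ≤ 4 * Real.exp (-(k m * (η ^ 2 / (2 * (1 + 2 * η / 3))))) ∧
      ∀ ω ∈ A, ∀ σ : Equiv.Perm (Fin (n m)), IsNormSorted (fun i => S (n m) i ω) σ →
        ‖empTens e (fun i => S (n m) i ω) σ (k m) -
          ((spectralMeasure μ).real univ)⁻¹ • ∫ x, tens e x x ∂(spectralMeasure μ)‖ < 5 * η := by
  obtain ⟨hpos, hratio, hlim⟩ := hRV.tail e hX
  set w := ((spectralMeasure μ).real univ)⁻¹ • ∫ x, tens e x x ∂(spectralMeasure μ)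
  have hq : ∀ m, ∃ s, 1 ≤ k m → k m ≤ n m →
      P.real {ω | s < ‖X ω‖} ≤ (k m : ℝ) / n m ∧ (k m : ℝ) / n m ≤ P.real {ω | s ≤ ‖X ω‖} := by
    intro m
    by_cases h : 1 ≤ k m ∧ k m ≤ n m
    · have hk0 : (0 : ℝ) < k m := by exact_mod_cast h.1
      have hn0 : (0 : ℝ) < n m := by exact_mod_cast h.1.trans h.2
      obtain ⟨s, hs⟩ := exists_upper_quantile (P := P) hX.norm (fun ω => norm_nonneg _)
        (div_pos hk0 hn0) ((div_le_one hn0).2 (by exact_mod_cast h.2))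
      exact ⟨s, fun _ _ => hs⟩
    · exact ⟨0, fun h1 h2 => absurd ⟨h1, h2⟩ h⟩
  choose s hs using hq
  have hk1 : ∀ᶠ m in atTop, 1 ≤ k m := hk.eventually_ge_atTop 1
  have hkn1 : ∀ᶠ m in atTop, k m ≤ n m := by
    filter_upwards [hkn.eventually (gt_mem_nhds one_pos), hn.eventually_ge_atTop 1] with m h1 h2
    have hn0 : (0 : ℝ) < n m := by exact_mod_cast h2
    rw [div_lt_one hn0] at h1
    exact_mod_cast h1.le
  -- `P(R > M')` is positive for arbitrarily large `M'`, while `P(R > s m) ≤ k m / n m → 0`.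
  have hsInf : Tendsto s atTop atTop := by
    rw [tendsto_atTop]
    intro M
    obtain ⟨M', hM', hMM'⟩ := (hpos.and (eventually_ge_atTop M)).exists
    filter_upwards [hk1, hkn1, hkn.eventually (gt_mem_nhds hM')] with m h1 h2 h3
    by_contra! hlt
    have h4 : P.real {ω | M' < ‖X ω‖} ≤ P.real {ω | s m < ‖X ω‖} :=
      measureReal_mono fun ω (hω : M' < ‖X ω‖) =>
        show s m < ‖X ω‖ from hlt.trans_le (hMM'.trans hω.le)
    linarith [(hs m h1 h2).1]
  -- The ratio lies between `P(R > s m) / P(R ≥ s m)`, which tends to `1`, and `1`.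
  have hqk : Tendsto (fun m => P.real {ω | s m < ‖X ω‖} / ((k m : ℝ) / n m)) atTop (𝓝 1) := by
    refine tendsto_of_tendsto_of_tendsto_of_le_of_le' (hratio.comp hsInf) tendsto_const_nhds ?_ ?_
    · filter_upwards [hk1, hkn1] with m h1 h2
      have hk0 : (0 : ℝ) < k m := by exact_mod_cast h1
      have hn0 : (0 : ℝ) < n m := by exact_mod_cast h1.trans h2
      exact div_le_div_of_nonneg_left measureReal_nonneg (div_pos hk0 hn0) (hs m h1 h2).2
    · filter_upwards [hk1, hkn1] with m h1 h2
      exact div_le_one_of_le₀ (hs m h1 h2).1 (by positivity)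
  have hmean : Tendsto (fun m => ((n m : ℝ) / k m) • exceedMean e P X (s m)) atTop (𝓝 w) := by
    have h1 := hqk.smul (hlim.comp hsInf)
    rw [one_smul] at h1
    refine h1.congr' ?_
    filter_upwards [hsInf.eventually hpos] with m hm
    rw [Function.comp_apply, smul_smul, div_mul_eq_mul_div, mul_inv_cancel₀ hm.ne', one_div,
      inv_div]
  filter_upwards [hk1, hkn1, hqk.eventually (lt_mem_nhds (by linarith : 1 - η < 1)),
    hmean.eventually (Metric.ball_mem_nhds w hη)] with m h1 h2 h3 h4
  have hk0 : (0 : ℝ) < k m := by exact_mod_cast h1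
  have hn0 : (0 : ℝ) < n m := by exact_mod_cast h1.trans h2
  have hnq : n m * P.real {ω | s m < ‖X ω‖} ≤ k m := by
    have := (hs m h1 h2).1
    rwa [le_div_iff₀ hn0, mul_comm] at this
  -- Deviation `r = η k` with variance budget `k`, so the exponent is linear in `k`. The
  -- fluctuations contribute `2η`, the count bias at most `η` and the convergence of the mean less
  -- than `η`, within the stated `5η`.
  obtain ⟨A, -, hPA, hA⟩ := exists_event_norm_empTens_sub_le e hX (hS (n m)) (hlaw (n m)) (s m)
    hk0 hnq (mul_nonneg hη.le hk0.le)
  refine ⟨A, ?_, fun ω hω σ hσ => ?_⟩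
  · convert hPA using 4
    field_simp
  · have h5 := hA ω hω (k m) h1 h2 σ hσ
    have h6 : (2 * (η * k m) + |n m * P.real {ω | s m < ‖X ω‖} - k m|) / k m ≤ 3 * η := by
      rw [abs_of_nonpos (by linarith), div_le_iff₀ hk0]
      rw [lt_div_iff₀ (div_pos hk0 hn0), mul_div_assoc', div_lt_iff₀ hn0] at h3
      linarith
    rw [dist_eq_norm] at h4
    have h7 := norm_sub_le_norm_sub_add_norm_sub (empTens e (fun i => S (n m) i ω) σ (k m))
      (((n m : ℝ) / k m) • exceedMean e P X (s m)) w
    linarith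

theorem consistency {X : Ω → H} (hX : Measurable X) {α : ℝ} {μ : Measure H}
    (hRV : IsRegularlyVarying P X α μ)
    {S : (n : ℕ) → Fin n → Ω → H} (hS : ∀ n, iIndepFun (S n) P)
    (hlaw : ∀ n i, IdentDistrib (S n i) X P P) {p : ℕ} (hp : 1 ≤ p)
    (hgap : 0 < eigengap (limitCov μ) p) {n k : ℕ → ℕ} (hn : Tendsto n atTop atTop)
    (hk : Tendsto k atTop atTop) (hkn : Tendsto (fun m => (k m : ℝ) / n m) atTop (𝓝 0))
    {σ : (m : ℕ) → Ω → Equiv.Perm (Fin (n m))}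
    (hσ : ∀ m ω, IsNormSorted (fun i => S (n m) i ω) (σ m ω))
    {W : ℕ → Ω → Submodule ℝ H} [∀ m ω, FiniteDimensional ℝ (W m ω)]
    {V : Submodule ℝ H} [FiniteDimensional ℝ V]
    (hW : ∀ m ω, IsLeadingEigenspace (empCov (fun i => S (n m) i ω) (σ m ω) (k m)) p (W m ω))
    (hV : IsLeadingEigenspace (limitCov μ) p V) {ε : ℝ} (hε : 0 < ε) :
    Tendsto (fun m => P {ω | ENNReal.ofReal ε ≤ rho (W m ω) V}) atTop (𝓝 0) := by
  obtain ⟨b, hb⟩ := (exists_hilbertBasis ℝ H).choose_spec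
  have hprob := hRV.isProbabilityMeasure_angularMeasure
  set D := eigengap (limitCov μ) p
  set η := ε * D / 5 with hηd
  have hη : 0 < η := by positivity
  set c := η ^ 2 / (2 * (1 + 2 * η / 3))
  have hc0 : 0 < c := by positivity
  have hexp : Tendsto (fun m => ENNReal.ofReal (4 * Real.exp (-(k m * c)))) atTop (𝓝 0) := by
    have h1 : Tendsto (fun m => (k m : ℝ) * c) atTop atTop :=
      (tendsto_natCast_atTop_atTop.comp hk).atTop_mul_const hc0
    have h2 := (Real.tendsto_exp_neg_atTop_nhds_zero.comp h1).const_mul 4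
    simpa using ENNReal.tendsto_ofReal h2
  refine tendsto_of_tendsto_of_tendsto_of_le_of_le' tendsto_const_nhds hexp
    (Eventually.of_forall fun _ => zero_le) ?_
  filter_upwards [eventually_exists_event_norm_empTens_sub_lt b hX hRV hS hlaw hn hk hkn hη]
    with m ⟨A, hPA, hA⟩
  -- The choice `η = ε D / 5` turns the error `5η` into `ε` after division by the gap. Inclusion in
  -- `Aᶜ` suffices, so an arbitrary, possibly nonmeasurable, choice of eigenspaces is allowed.
  have hsub : {ω | ENNReal.ofReal ε ≤ rho (W m ω) V} ⊆ Aᶜ := by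
    intro ω hω hωA
    have h1 := hA ω hωA (σ m ω) (hσ m ω)
    have h2 := rho_le_of_represents (A := limitCov μ) hb (isCov_integral fun s => isCov_tensorSq s)
      (isCov_empCov _ (σ m ω) (k m)) (represents_limitCov b hRV)
      (represents_empTens b (fun i => S (n m) i ω) (σ m ω) (k m)) hp hgap (hW m ω) hV
    have h3 : ENNReal.ofReal ε ≤ rho (W m ω) V := hω
    refine absurd (h3.trans h2) (not_le.2 ?_)
    rw [ENNReal.ofReal_lt_ofReal_iff hε, div_lt_iff₀ hgap]
    refine h1.trans_le (le_of_eq ?_)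
    rw [hηd]; ring
  refine (measure_mono hsub).trans ?_
  rw [← ofReal_measureReal]
  exact ENNReal.ofReal_le_ofReal hPA

end Consistency

end ExtremePCA

end

theorem mainTheorem5
    {H : Type*} [NormedAddCommGroup H] [InnerProductSpace ℝ H] [CompleteSpace H]
    [TopologicalSpace.SeparableSpace H] [MeasurableSpace H] [BorelSpace H]
    {Ω : Type*} [MeasurableSpace Ω] (P : Measure Ω) [IsProbabilityMeasure P]
    -- the regularly varying random element
    (X : Ω → H) (hX : Measurable X) (α : ℝ) (hα : 0 < α) (μ : Measure H)
    (hRV : ExtremePCA.IsRegularlyVarying P X α μ)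
    -- for every `n`, an independent sample of size `n` distributed as `X`
    (S : (n : ℕ) → Fin n → Ω → H) (hS_indep : ∀ n, iIndepFun (S n) P)
    (hS_law : ∀ n i, IdentDistrib (S n i) X P P)
    (p : ℕ) (hp : 1 ≤ p) (hgap : 0 < ExtremePCA.eigengap (ExtremePCA.limitCov μ) p) :
    -- finite sample bound
    (∀ n k : ℕ, 1 ≤ k → k ≤ n →
      P.real {ω | ExtremePCA.radialQuantile P X n k < ‖X ω‖} = (k : ℝ) / n →
      0 < ExtremePCA.eigengap
        (ExtremePCA.condCov P X (ExtremePCA.radialQuantile P X n k)) p →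
      ∀ δ : ℝ, 0 < δ → δ < 1 →
        ∃ A : Set Ω, MeasurableSet A ∧ 1 - δ ≤ P.real A ∧ ∀ ω ∈ A,
          ∀ σ : Equiv.Perm (Fin n), ExtremePCA.IsNormSorted (fun i => S n i ω) σ →
          ∀ (Vhat V : Submodule ℝ H) [FiniteDimensional ℝ Vhat] [FiniteDimensional ℝ V],
            ExtremePCA.IsLeadingEigenspace
              (ExtremePCA.empCov (fun i => S n i ω) σ k) p Vhat →
            ExtremePCA.IsLeadingEigenspace
              (ExtremePCA.condCov P X (ExtremePCA.radialQuantile P X n k)) p V →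
            ExtremePCA.rho Vhat V ≤ ENNReal.ofReal
              (ExtremePCA.statBound k δ / ExtremePCA.eigengap
                (ExtremePCA.condCov P X (ExtremePCA.radialQuantile P X n k)) p)) ∧
    -- consistency: convergence in probability along all sequences `n, k → ∞` with `k / n → 0`
    (∀ n k : ℕ → ℕ, Tendsto n atTop atTop → Tendsto k atTop atTop →
      Tendsto (fun m => (k m : ℝ) / n m) atTop (𝓝 0) →
      ∀ σ : (m : ℕ) → Ω → Equiv.Perm (Fin (n m)),
        (∀ m ω, ExtremePCA.IsNormSorted (fun i => S (n m) i ω) (σ m ω)) →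
      ∀ (Vhat : ℕ → Ω → Submodule ℝ H) [∀ m ω, FiniteDimensional ℝ (Vhat m ω)]
        (V : Submodule ℝ H) [FiniteDimensional ℝ V],
        (∀ m ω, ExtremePCA.IsLeadingEigenspace
          (ExtremePCA.empCov (fun i => S (n m) i ω) (σ m ω) (k m)) p (Vhat m ω)) →
        ExtremePCA.IsLeadingEigenspace (ExtremePCA.limitCov μ) p V →
        ∀ ε : ℝ, 0 < ε →
          Tendsto (fun m => P {ω | ENNReal.ofReal ε ≤ ExtremePCA.rho (Vhat m ω) V}) atTop (𝓝 0)) := by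
  refine ⟨fun n k hk hkn ht hgapt δ hδ hδ1 => ?_, fun n k hn hk hkn σ hσ W _ V _ hW hV ε hε => ?_⟩
  · exact ExtremePCA.finite_sample_bound hX (hS_indep n) (hS_law n) hp hk hkn ht hgapt hδ hδ1
  · exact ExtremePCA.consistency hX hRV hS_indep hS_law hp hgap hn hk hkn hσ hW hV hε
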